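/- For integers $1\le s\le p$ and $\gamma\in[0,1)$ let $P_{\theta,\gamma}=N(\theta,(1-\gamma)I_p+\gamma\mathbf 1_p\mathbf 1_p^{\top})$ on $\mathbb R^p$, and for $\varepsilon\in\mathbb R$ put $$\Theta_{\mathcal I}(p,s,\varepsilon)=\{\theta\in\mathbb R^p:\ \|\theta-\bar\theta\mathbf 1_p\|\ge\varepsilon,\ \|\theta\|_0\le s\},\qquad \bar\theta=\tfrac1p\sum_{i=1}^p\theta_i,$$ where $\|\cdot\|$ is the Euclidean norm and $\|\theta\|_0$ is the number of nonzero coordinates of $\theta$. Let $$\mathcal R_{\mathcal I}(\varepsilon)=\mathcal R_{\mathcal I}(\varepsilon;p,s,\gamma)=\inf_{\varphi}\Big\{P_{0,\gamma}\{\varphi=1\}+\sup_{\theta\in\Theta_{\mathcal I}(p,s,\varepsilon)}P_{\theta,\gamma}\{\varphi=0\}\Big\},$$ the infimum being over all measurable $\varphi:\mathbb R^p\to\{0,1\}$ and the supremum over the empty set being $0$. A real-valued function $\varepsilon_1^*=\varepsilon_1^*(p,s,\gamma)$, defined for all integers $p\ge2$, $1\le s\le p$ and all $\gamma\in[0,1)$,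 is called a minimax separation rate if for every $\eta\in(0,1)$ there are constants $C_\eta,c_\eta>0$ depending only on $\eta$ (not on $p,s,\gamma$) such that, for all such $(p,s,\gamma)$, $\mathcal R_{\mathcal I}(C\varepsilon_1^*)\le\eta$ for all $C>C_\eta$ and $\mathcal R_{\mathcal I}(c\varepsilon_1^*)\ge1-\eta$ for all $0<c<c_\eta$. Theorem. Let $$\psi_1^2=\psi_1^2(p,s,\gamma)=\begin{cases}(1-\gamma)\,s\log\!\big(1+\tfrac{p}{s^2}\big)&\text{if } s<\sqrt p,\\ (1-\gamma)\sqrt p&\text{if } s\ge\sqrt p,\end{cases}\qquad \psi_1=\sqrt{\psi_1^2}.$$ Then for $p\ge2$, $1\le s\le p$, $\gamma\in[0,1)$ we have $\varepsilon_1^*(p,s,\gamma)^2\asymp\psi_1^2$. That is, $\psi_1$ is a minimax separation rate, and for every minimax separation rate $\varepsilon_1^*$ there are constants $a,b>0$, not depending on $(p,s,\gamma)$, such that $a\,\psi_1^2\le\varepsilon_1^*(p,s,\gamma)^2\le b\,\psi_1^2$ for all integers $p\ge2$, $1\le s\le p$ and all $\gamma\in[0,1)$. -/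

import Mathlib

open MeasureTheory ProbabilityTheory
open scoped ENNReal

noncomputable section

namespace EquicorrelatedTesting

/-- The all-ones vector of `ℝᵖ`. -/
def ones (p : ℕ) : EuclideanSpace ℝ (Fin p) := WithLp.toLp 2 (fun _ => 1)

/-- The coordinate average `θ̄ = p⁻¹ ∑ᵢ θᵢ`. -/
def avg {p : ℕ} (θ : EuclideanSpace ℝ (Fin p)) : ℝ := (∑ i, θ i) / p

/-- The number `‖θ‖₀` of nonzero coordinates. -/
def sparsity {p : ℕ} (θ : EuclideanSpace ℝ (Fin p)) : ℕ :=
  (Finset.univ.filter (fun i => θ i ≠ 0)).card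

/-- The equicorrelation matrix `(1 - γ) Iₚ + γ 1ₚ 1ₚᵀ`. -/
def covMatrix (p : ℕ) (γ : ℝ) : Matrix (Fin p) (Fin p) ℝ :=
  (1 - γ) • (1 : Matrix (Fin p) (Fin p) ℝ) + γ • Matrix.vecMulVec (fun _ => 1) (fun _ => 1)

/-- For correlation levels in `[0, 1]` this is a genuine covariance matrix. -/
theorem covMatrix_posSemidef (p : ℕ) {γ : ℝ} (h0 : 0 ≤ γ) (h1 : γ ≤ 1) :
    (covMatrix p γ).PosSemidef := by
  have h : (Matrix.vecMulVec (fun _ => 1) (fun _ => 1) : Matrix (Fin p) (Fin p) ℝ).PosSemidef := by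
    simpa using Matrix.posSemidef_vecMulVec_self_star (R := ℝ) (fun _ : Fin p => 1)
  exact (Matrix.PosSemidef.one.smul (by linarith)).add (h.smul h0)

/-- The law `P_{θ,γ} = N(θ, (1 - γ) Iₚ + γ 1ₚ 1ₚᵀ)` of the observation. -/
def law {p : ℕ} (θ : EuclideanSpace ℝ (Fin p)) (γ : ℝ) : Measure (EuclideanSpace ℝ (Fin p)) :=
  multivariateGaussian θ (covMatrix p γ)

/-- The alternative of Problem I: `s`-sparse `θ` with `‖θ - θ̄ 1ₚ‖ ≥ ε`. -/
def alternative (p s : ℕ) (ε : ℝ) : Set (EuclideanSpace ℝ (Fin p)) :=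
  {θ | ε ≤ ‖θ - avg θ • ones p‖ ∧ sparsity θ ≤ s}

/-- The minimax testing risk of Problem I: the infimum over all measurable
`φ : ℝᵖ → {0, 1}` of type I error plus worst-case type II error. -/
def minimaxRisk (p s : ℕ) (γ ε : ℝ) : ℝ≥0∞ :=
  ⨅ (φ : EuclideanSpace ℝ (Fin p) → Fin 2) (_ : Measurable φ),
    law 0 γ {x | φ x = 1} + ⨆ θ ∈ alternative p s ε, law θ γ {x | φ x = 0}

/-- The configurations considered: `p ≥ 2`, `1 ≤ s ≤ p`, `γ ∈ [0, 1)`. -/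
def Config (p s : ℕ) (γ : ℝ) : Prop :=
  2 ≤ p ∧ 1 ≤ s ∧ s ≤ p ∧ 0 ≤ γ ∧ γ < 1

/-- `ε = ε(p, s, γ)` is a minimax separation rate for Problem I; the constants depend
only on `η`. Condition `upper` can only hold if `ε` is positive on all configurations, because the
alternative at a nonpositive radius contains `θ = 0`. -/
structure IsMinimaxSeparationRate (ε : ℕ → ℕ → ℝ → ℝ) : Prop where
  upper : ∀ η : ℝ, 0 < η → η < 1 → ∃ Cη : ℝ, 0 < Cη ∧
    ∀ (p s : ℕ) (γ : ℝ), Config p s γ → ∀ C : ℝ, Cη < C →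
      minimaxRisk p s γ (C * ε p s γ) ≤ ENNReal.ofReal η
  lower : ∀ η : ℝ, 0 < η → η < 1 → ∃ cη : ℝ, 0 < cη ∧
    ∀ (p s : ℕ) (γ : ℝ), Config p s γ → ∀ c : ℝ, 0 < c → c < cη →
      ENNReal.ofReal (1 - η) ≤ minimaxRisk p s γ (c * ε p s γ)

/-- The squared rate `ψ₁²`. -/
def psiSq (p s : ℕ) (γ : ℝ) : ℝ :=
  if (s : ℝ) < √(p : ℝ) then (1 - γ) * s * Real.log (1 + (p : ℝ) / (s : ℝ) ^ 2)
  else (1 - γ) * √(p : ℝ)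

end EquicorrelatedTesting

end

/-!
Writing the observation as `θ + √(1 - γ) z + √γ g 1` with independent standard Gaussian `z` and `g`
(`law_eq_map`), the problem becomes the detection of a sparse signal in white noise of level
`√(1 - γ)`, in the presence of an unknown common shift.

*Upper bound.* Tests invariant under common shifts do not see `g`
(`minimaxRisk_le_of_shiftInvariant`). For `s ≥ √p` the empirical variance `∑ᵢ (yᵢ - ȳ)²`, whose
fluctuations are of order `√p`, is enough (`exists_dense_test`). For `s < √p` the test rejects for
large values of `(∑ᵢ exp (l yᵢ)) (∑ᵢ exp (-l yᵢ))`, which is shift invariant, with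
`l² = log (1 + p / s²) / 2` (`exists_sparse_test`). Without signal both factors concentrate by
Chebyshev's inequality. With a signal, the coordinates outside the support still concentrate, and
those in the support contribute at least a constant multiple of `∑ᵢ exp (l |θᵢ|)`, reduced by a
factor `exp (-l K)`: discarding the coordinates with `|zᵢ| ≥ K` loses little weight on average, so
that no second moment under the alternative is needed (`noise_lost_weight_le`). By convexity the
least favourable signal is spread evenly over `s` coordinates (`mul_exp_le_sum_exp_abs`). This
requires `p` to exceed a constant depending on the error level; below it the dense test is rate
optimal for every `s`.

*Lower bound.* Conditionally on `g` the model is white noise, and the second moment method applies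
(`le_minimaxRisk_of_secondMoment`). The prior puts one spike at a uniform position in each of `k`
disjoint blocks of `⌊p / k⌋` coordinates. The overlap of two such signals is then exactly binomial,
so the second moment of the likelihood ratio factorizes (`sum_exp_overlap`). One takes `k = s` in
the sparse regime and `k = ⌊√p⌋` in the dense one (`exists_lower_const`).

*Uniqueness.* The risk is nonincreasing in the radius. At error level `1 / 4`, a large multiple of
one separation rate therefore exceeds a small multiple of any other
(`IsMinimaxSeparationRate.exists_mul_lt`).
-/

namespace EquicorrelatedTesting

/-! ### The one-factor representation -/

/-- The law `N(0, Iₚ)` of `p` independent standard Gaussian variables, on plain functions. -/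
noncomputable abbrev noise (p : ℕ) : Measure (Fin p → ℝ) := Measure.pi fun _ => gaussianReal 0 1

/-- The observation with mean `θ` produced by independent noise `z` and a common factor `g`. -/
noncomputable def observe {p : ℕ} (θ : EuclideanSpace ℝ (Fin p)) (γ : ℝ) (z : Fin p → ℝ) (g : ℝ) :
    EuclideanSpace ℝ (Fin p) :=
  θ + √(1 - γ) • WithLp.toLp 2 z + (√γ * g) • ones p

lemma observe_apply {p : ℕ} (θ : EuclideanSpace ℝ (Fin p)) (γ : ℝ) (z : Fin p → ℝ) (g : ℝ)
    (i : Fin p) : observe θ γ z g i = θ i + √(1 - γ) * z i + √γ * g := by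
  simp [observe, ones]

lemma measurable_observe {p : ℕ} (θ : EuclideanSpace ℝ (Fin p)) (γ : ℝ) :
    Measurable fun w : (Fin p → ℝ) × ℝ => observe θ γ w.1 w.2 := by
  unfold observe
  fun_prop

lemma dotProduct_covMatrix_mulVec {p : ℕ} (γ : ℝ) (t : Fin p → ℝ) :
    t ⬝ᵥ (covMatrix p γ).mulVec t = (1 - γ) * ∑ i, t i ^ 2 + γ * (∑ i, t i) ^ 2 := by
  have h : (covMatrix p γ).mulVec t = fun i => (1 - γ) * t i + γ * ∑ j, t j := by
    ext i
    simp [covMatrix, Matrix.add_mulVec, Matrix.smul_mulVec, Matrix.vecMulVec_mulVec, dotProduct]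
  rw [h]
  simp only [dotProduct, mul_add, Finset.sum_add_distrib, Finset.mul_sum]
  rw [sq, Finset.sum_mul_sum, Finset.mul_sum]
  congr 1
  · exact Finset.sum_congr rfl fun i _ => by ring
  · refine Finset.sum_congr rfl fun i _ => ?_
    rw [Finset.mul_sum]
    exact Finset.sum_congr rfl fun j _ => by ring

/-- One-factor representation of the equicorrelated Gaussian law. -/
lemma law_eq_map {p : ℕ} (θ : EuclideanSpace ℝ (Fin p)) {γ : ℝ} (h0 : 0 ≤ γ) (h1 : γ ≤ 1) :
    law θ γ = ((noise p).prod (gaussianReal 0 1)).map (fun w => observe θ γ w.1 w.2) := by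
  have := Measure.isProbabilityMeasure_map (μ := (noise p).prod (gaussianReal 0 1))
    (measurable_observe θ γ).aemeasurable
  have hlaw : IsProbabilityMeasure (law θ γ) := by unfold law; infer_instance
  refine Measure.ext_of_charFun (E := EuclideanSpace ℝ (Fin p)) ?_
  ext t
  rw [law, charFun_multivariateGaussian (covMatrix_posSemidef p h0 h1), charFun_apply,
    integral_map (measurable_observe θ γ).aemeasurable
      (Measurable.aestronglyMeasurable (by fun_prop))]
  have hsplit : ∀ w : (Fin p → ℝ) × ℝ,
      Complex.exp (inner ℝ (observe θ γ w.1 w.2) t * Complex.I) =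
        Complex.exp (inner ℝ t θ * Complex.I) *
          (Complex.exp (inner ℝ (WithLp.toLp 2 w.1) (√(1 - γ) • t) * Complex.I) *
            Complex.exp ((√γ * ∑ i, t i : ℝ) * w.2 * Complex.I)) := by
    intro w
    rw [← Complex.exp_add, ← Complex.exp_add, ← add_mul, ← add_mul]
    congr 2
    have : inner ℝ (ones p) t = ∑ i, t i := by simp [ones, PiLp.inner_apply]
    simp only [observe, inner_add_left, real_inner_smul_left, real_inner_smul_right, this,
      real_inner_comm θ t]
    push_cast
    ring
  simp_rw [hsplit]
  rw [integral_const_mul, integral_prod_mul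
    (f := fun z : Fin p → ℝ => Complex.exp (inner ℝ (WithLp.toLp 2 z) (√(1 - γ) • t) * Complex.I))
    (g := fun g : ℝ => Complex.exp ((√γ * ∑ i, t i : ℝ) * g * Complex.I))]
  have hz : ∫ z : Fin p → ℝ,
      Complex.exp (inner ℝ (WithLp.toLp 2 z) (√(1 - γ) • t) * Complex.I) ∂(noise p)
        = Complex.exp (-((1 - γ) * ∑ i, t i ^ 2 : ℝ) / 2) := by
    rw [← integral_map (μ := noise p) (φ := WithLp.toLp 2)
      (f := fun x : EuclideanSpace ℝ (Fin p) =>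
        Complex.exp (inner ℝ x (√(1 - γ) • t) * Complex.I)) (by fun_prop)
      (Measurable.aestronglyMeasurable (by fun_prop)), map_pi_eq_stdGaussian, ← charFun_apply,
      charFun_stdGaussian, ← Complex.ofReal_pow, norm_smul, mul_pow,
      EuclideanSpace.real_norm_sq_eq, Real.norm_eq_abs, sq_abs, Real.sq_sqrt (by linarith)]
  have hg : ∫ g : ℝ, Complex.exp ((√γ * ∑ i, t i : ℝ) * g * Complex.I) ∂(gaussianReal 0 1)
        = Complex.exp (-(γ * (∑ i, t i) ^ 2 : ℝ) / 2) := by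
    rw [← charFun_apply_real, charFun_gaussianReal]
    have : (√γ * ∑ i, t i) ^ 2 = γ * (∑ i, t i) ^ 2 := by rw [mul_pow, Real.sq_sqrt h0]
    rw [← this]
    push_cast
    simp [neg_div]
  rw [hz, hg, ← Complex.exp_add, ← Complex.exp_add, dotProduct_covMatrix_mulVec]
  congr 1
  push_cast
  ring

/-- Conditioning on the common factor: an event under the equicorrelated law is averaged over its
sections, which are events for independent noise. -/
lemma law_apply {p : ℕ} (θ : EuclideanSpace ℝ (Fin p)) {γ : ℝ} (h0 : 0 ≤ γ) (h1 : γ ≤ 1)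
    {E : Set (EuclideanSpace ℝ (Fin p))} (hE : MeasurableSet E) :
    law θ γ E = ∫⁻ g, noise p {z | observe θ γ z g ∈ E} ∂(gaussianReal 0 1) := by
  rw [law_eq_map θ h0 h1, Measure.map_apply (measurable_observe θ γ) hE,
    Measure.prod_apply_symm (measurable_observe θ γ hE)]
  rfl

/-! ### Reduction to shift-invariant tests and concentration tools -/

/-- A rejection region invariant under common shifts does not see the common factor, so its errors
may be computed for independent standard noise, in units of `√(1 - γ)`. -/
lemma minimaxRisk_le_of_shiftInvariant {p s : ℕ} {γ ε : ℝ} (h0 : 0 ≤ γ) (h1 : γ < 1) (hε : 0 ≤ ε)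
    {R : Set (Fin p → ℝ)} (hR : MeasurableSet R)
    (hinv : ∀ (y : Fin p → ℝ) (c : ℝ), (fun i => y i + c) ∈ R ↔ y ∈ R) {α β : ℝ≥0∞}
    (hα : noise p R ≤ α)
    (hβ : ∀ ϑ : Fin p → ℝ, (Finset.univ.filter fun i => ϑ i ≠ 0).card ≤ s →
      ε ^ 2 ≤ (1 - γ) * ∑ i, (ϑ i - (∑ j, ϑ j) / p) ^ 2 →
      noise p {z | (fun i => ϑ i + z i) ∉ R} ≤ β) :
    minimaxRisk p s γ ε ≤ α + β := by
  classical
  set σ := √(1 - γ) with hσ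
  have hσ0 : 0 < σ := Real.sqrt_pos.2 (by linarith)
  have hσ2 : σ ^ 2 = 1 - γ := Real.sq_sqrt (by linarith)
  set R' : Set (EuclideanSpace ℝ (Fin p)) := {x | (fun i => x i / σ) ∈ R} with hR'
  have hm : Measurable fun (x : EuclideanSpace ℝ (Fin p)) (i : Fin p) => x i / σ := by fun_prop
  have hR'm : MeasurableSet R' := hm hR
  have hobs : ∀ (θ : EuclideanSpace ℝ (Fin p)) (z : Fin p → ℝ) (g : ℝ),
      observe θ γ z g ∈ R' ↔ (fun i => θ i / σ + z i) ∈ R := by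
    intro θ z g
    rw [← hinv _ (√γ * g / σ), hR', Set.mem_ofPred_eq]
    have : (fun i => observe θ γ z g i / σ) = fun i => θ i / σ + z i + √γ * g / σ := by
      funext i
      rw [observe_apply, ← hσ]
      field_simp
    rw [this]
  refine (iInf₂_le (fun x => if x ∈ R' then 1 else 0)
    (Measurable.ite hR'm measurable_const measurable_const)).trans (add_le_add ?_ ?_)
  · have hset : {x | (if x ∈ R' then (1 : Fin 2) else 0) = 1} = R' := by
      ext x; simp
    rw [hset, law_apply 0 h0 h1.le hR'm]
    simp only [hobs, PiLp.zero_apply, zero_div, zero_add, lintegral_const, measure_univ, mul_one]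
    exact hα
  · refine iSup₂_le fun θ hθ => ?_
    have hset : {x | (if x ∈ R' then (1 : Fin 2) else 0) = 0} = R'ᶜ := by
      ext x; simp
    rw [hset, law_apply θ h0 h1.le hR'm.compl]
    simp only [Set.mem_compl_iff, hobs]
    rw [lintegral_const, measure_univ, mul_one]
    refine hβ _ ?_ ?_
    · refine le_trans (le_of_eq ?_) hθ.2
      simp [sparsity, hσ0.ne']
    · have h := pow_le_pow_left₀ hε hθ.1 2
      refine h.trans (le_of_eq ?_)
      rw [EuclideanSpace.real_norm_sq_eq, ← hσ2, Finset.mul_sum]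
      refine Finset.sum_congr rfl fun i _ => ?_
      rw [← Finset.sum_div, ← mul_pow]
      simp only [avg, ones, PiLp.sub_apply, PiLp.smul_apply, smul_eq_mul, mul_one]
      field_simp

/-- Chebyshev's inequality for a sum of functions of independent Gaussian variables. -/
lemma noise_deviation_le {p : ℕ} {f : Fin p → ℝ → ℝ}
    (hf : ∀ i, MemLp (f i) 2 (gaussianReal 0 1)) {t : ℝ} (ht : 0 < t) :
    noise p {z | t ≤ |∑ i, f i (z i) - ∑ i, ∫ x, f i x ∂(gaussianReal 0 1)|} ≤
      ENNReal.ofReal ((∑ i, Var[f i; gaussianReal 0 1]) / t ^ 2) := by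
  have hmem : ∀ i, MemLp (fun z : Fin p → ℝ => f i (z i)) 2 (noise p) := fun i =>
    (hf i).comp_measurePreserving (measurePreserving_eval _ i)
  have h := meas_ge_le_variance_div_sq (μ := noise p) (X := ∑ i, fun z => f i (z i))
    (memLp_finsetSum' _ fun i _ => hmem i) ht
  rw [variance_sum_pi hf] at h
  have hint : ∫ z, (∑ i, fun z : Fin p → ℝ => f i (z i)) z ∂(noise p) =
      ∑ i, ∫ x, f i x ∂(gaussianReal 0 1) := by
    simp only [Finset.sum_apply]
    rw [integral_finsetSum _ fun i _ => (hmem i).integrable one_le_two]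
    exact Finset.sum_congr rfl fun i _ => integral_comp_eval (hf i).aestronglyMeasurable
  rw [hint] at h
  simpa only [Finset.sum_apply] using h

lemma integral_exp_gaussian (l : ℝ) :
    ∫ x, Real.exp (l * x - l ^ 2 / 2) ∂(gaussianReal 0 1) = 1 := by
  have h := congrFun (mgf_fun_id_gaussianReal (μ := 0) (v := 1)) l
  simp only [mgf, zero_mul, NNReal.coe_one, one_mul, zero_add] at h
  simp_rw [Real.exp_sub]
  rw [integral_div, h, div_self (Real.exp_ne_zero _)]

lemma memLp_exp_gaussian (l : ℝ) :
    MemLp (fun x => Real.exp (l * x - l ^ 2 / 2)) 2 (gaussianReal 0 1) := by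
  rw [memLp_two_iff_integrable_sq (Measurable.aestronglyMeasurable (by fun_prop))]
  have h := (integrable_exp_mul_gaussianReal (μ := 0) (v := 1) (2 * l)).mul_const
    (Real.exp (-l ^ 2))
  refine h.congr (Filter.Eventually.of_forall fun x => ?_)
  simp only [← Real.exp_add, ← Real.exp_nat_mul]
  congr 1
  push_cast
  ring

lemma variance_exp_gaussian_le (l : ℝ) :
    Var[fun x => Real.exp (l * x - l ^ 2 / 2); gaussianReal 0 1] ≤ Real.exp (l ^ 2) := by
  refine (variance_le_expectation_sq (Measurable.aestronglyMeasurable (by fun_prop))).trans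
    (le_of_eq ?_)
  have h : ∀ x : ℝ, (Real.exp (l * x - l ^ 2 / 2)) ^ 2 =
      Real.exp (l ^ 2) * Real.exp ((2 * l) * x - (2 * l) ^ 2 / 2) := by
    intro x
    rw [← Real.exp_add, ← Real.exp_nat_mul]
    congr 1
    push_cast
    ring
  simp only [Pi.pow_apply, h]
  rw [integral_const_mul, integral_exp_gaussian, mul_one]

/-- Fluctuations of an exponential statistic restricted to a set `S` of coordinates. -/
lemma noise_exp_deviation_le {p : ℕ} (S : Finset (Fin p)) (l : ℝ) {t : ℝ} (ht : 0 < t) :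
    noise p {z | t ≤ |∑ i ∈ S, Real.exp (l * z i - l ^ 2 / 2) - S.card|} ≤
      ENNReal.ofReal (p * Real.exp (l ^ 2) / t ^ 2) := by
  classical
  set f : Fin p → ℝ → ℝ := fun i x =>
    (if i ∈ S then 1 else 0) * Real.exp (l * x - l ^ 2 / 2) with hf
  have h := noise_deviation_le (f := f) (fun i => (memLp_exp_gaussian l).const_mul _) ht
  have e1 : ∀ z : Fin p → ℝ, ∑ i, f i (z i) = ∑ i ∈ S, Real.exp (l * z i - l ^ 2 / 2) := by
    intro z
    simp [hf]
  have e2 : ∑ i, ∫ x, f i x ∂(gaussianReal 0 1) = S.card := by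
    simp only [hf, integral_const_mul, integral_exp_gaussian]
    simp
  simp only [e1, e2] at h
  refine h.trans (ENNReal.ofReal_le_ofReal (div_le_div_of_nonneg_right ?_ (by positivity)))
  have hv : ∀ i ∈ Finset.univ, Var[f i; gaussianReal 0 1] ≤ Real.exp (l ^ 2) := by
    intro i _
    have hvi : Var[f i; gaussianReal 0 1] = (if i ∈ S then 1 else 0) ^ 2 *
        Var[fun x => Real.exp (l * x - l ^ 2 / 2); gaussianReal 0 1] := variance_const_mul _ _ _
    rw [hvi]
    split_ifs
    · simpa using variance_exp_gaussian_le l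
    · simpa using (Real.exp_pos _).le
  simpa using Finset.sum_le_sum hv

lemma gaussian_abs_ge_le {K : ℝ} (hK : 0 < K) :
    (gaussianReal 0 1).real {x | K ≤ |x|} ≤ 1 / K ^ 2 := by
  have h := meas_ge_le_variance_div_sq (μ := gaussianReal 0 1) (X := id)
    (memLp_id_gaussianReal 2) hK
  rw [variance_id_gaussianReal] at h
  simp only [id, integral_id_gaussianReal, sub_zero, NNReal.coe_one] at h
  exact ENNReal.toReal_le_of_le_ofReal (by positivity) h

/-- Removing the coordinates with large noise costs at most half of a nonnegative weight, with high
probability. Only the mean of the removed weight is used, so no single weight has to be small. -/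
lemma noise_lost_weight_le {p : ℕ} (S : Finset (Fin p)) {a : Fin p → ℝ} (ha : ∀ i ∈ S, 0 < a i)
    (hS : S.Nonempty) {K : ℝ} (hK : 0 < K) :
    noise p {z | (∑ i ∈ S, a i) / 2 ≤ ∑ i ∈ S, a i * ({x : ℝ | K ≤ |x|}.indicator 1 (z i))} ≤
      ENNReal.ofReal (2 / K ^ 2) := by
  have hB : MeasurableSet {x : ℝ | K ≤ |x|} := measurableSet_le measurable_const (by fun_prop)
  have hpos : 0 < ∑ i ∈ S, a i := Finset.sum_pos ha hS
  have hInt : Integrable ({x : ℝ | K ≤ |x|}.indicator (1 : ℝ → ℝ)) (gaussianReal 0 1) :=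
    (integrable_const (1 : ℝ)).indicator hB
  have hint : ∀ i, Integrable (fun z : Fin p → ℝ => a i * ({x : ℝ | K ≤ |x|}.indicator 1 (z i)))
      (noise p) := fun i =>
    (((measurePreserving_eval (fun _ : Fin p => gaussianReal 0 1) i).integrable_comp
      hInt.aestronglyMeasurable).2 hInt).const_mul _
  have hmean : ∫ z, ∑ i ∈ S, a i * ({x : ℝ | K ≤ |x|}.indicator 1 (z i)) ∂(noise p) ≤
      (∑ i ∈ S, a i) * (1 / K ^ 2) := by
    rw [integral_finsetSum _ fun i _ => hint i, Finset.sum_mul]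
    refine Finset.sum_le_sum fun i hi => ?_
    rw [integral_const_mul]
    refine mul_le_mul_of_nonneg_left ?_ (ha i hi).le
    rw [integral_comp_eval (μ := fun _ : Fin p => gaussianReal 0 1)
      (f := {x : ℝ | K ≤ |x|}.indicator (1 : ℝ → ℝ)) hInt.aestronglyMeasurable,
      integral_indicator_one hB]
    exact gaussian_abs_ge_le hK
  have hmarkov := mul_meas_ge_le_integral_of_nonneg (μ := noise p)
    (f := fun z => ∑ i ∈ S, a i * ({x : ℝ | K ≤ |x|}.indicator 1 (z i)))
    (Filter.Eventually.of_forall fun z => Finset.sum_nonneg fun i hi =>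
      mul_nonneg (ha i hi).le (Set.indicator_nonneg (fun _ _ => zero_le_one) _))
    (integrable_finsetSum _ fun i _ => hint i) ((∑ i ∈ S, a i) / 2)
  have h2 := hmarkov.trans hmean
  rw [← ofReal_measureReal]
  refine ENNReal.ofReal_le_ofReal ?_
  have h3 : (∑ i ∈ S, a i) / 2 * (noise p).real {z | (∑ i ∈ S, a i) / 2 ≤
      ∑ i ∈ S, a i * ({x : ℝ | K ≤ |x|}.indicator 1 (z i))} ≤
      (∑ i ∈ S, a i) / 2 * (2 / K ^ 2) := h2.trans (le_of_eq (by ring))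
  exact le_of_mul_le_mul_left h3 (by positivity)

/-! ### The test based on the empirical variance -/

lemma sum_sub_avg_sq {p : ℕ} (x : Fin p → ℝ) :
    ∑ i, (x i - (∑ j, x j) / p) ^ 2 = ∑ i, x i ^ 2 - (∑ i, x i) ^ 2 / p := by
  rcases Nat.eq_zero_or_pos p with rfl | hp
  · simp
  have hp' : (p : ℝ) ≠ 0 := by positivity
  simp only [sub_sq, Finset.sum_add_distrib, Finset.sum_sub_distrib, ← Finset.sum_mul,
    ← Finset.mul_sum, Finset.sum_const, Finset.card_univ, Fintype.card_fin, nsmul_eq_mul]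
  field_simp
  ring

lemma sum_sub_avg_eq_zero {p : ℕ} (x : Fin p → ℝ) : ∑ i, (x i - (∑ j, x j) / p) = 0 := by
  rcases Nat.eq_zero_or_pos p with rfl | hp
  · simp
  have hp' : (p : ℝ) ≠ 0 := by positivity
  rw [Finset.sum_sub_distrib]
  simp
  field_simp
  ring

/-- Empirical variance of signal plus noise, expanded around the centred signal. -/
lemma sum_signal_add_noise_sub_avg_sq {p : ℕ} (x z : Fin p → ℝ) :
    ∑ i, (x i + z i - (∑ j, (x j + z j)) / p) ^ 2 =
      ∑ i, (x i - (∑ j, x j) / p) ^ 2 + 2 * ∑ i, (x i - (∑ j, x j) / p) * z i +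
        (∑ i, z i ^ 2 - (∑ i, z i) ^ 2 / p) := by
  have h0 := sum_sub_avg_eq_zero x
  set u : Fin p → ℝ := fun i => x i - (∑ j, x j) / p with hu
  have h1 : ∀ i, (x i + z i - (∑ j, (x j + z j)) / p) ^ 2 =
      u i ^ 2 + 2 * (u i * z i) - 2 * ((∑ j, z j) / p) * u i + (z i - (∑ j, z j) / p) ^ 2 := by
    intro i
    rw [hu, Finset.sum_add_distrib]
    ring
  rw [Finset.sum_congr rfl fun i _ => h1 i, Finset.sum_add_distrib, Finset.sum_sub_distrib,
    Finset.sum_add_distrib, sum_sub_avg_sq z, ← Finset.mul_sum, ← Finset.mul_sum, h0, mul_zero,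
    sub_zero]

lemma memLp_sq_gaussian : MemLp (fun x : ℝ => x ^ 2) 2 (gaussianReal 0 1) := by
  rw [memLp_two_iff_integrable_sq (Measurable.aestronglyMeasurable (by fun_prop))]
  have h := (memLp_id_gaussianReal (μ := 0) (v := 1) 4).integrable_norm_pow (by norm_num)
  refine h.congr (Filter.Eventually.of_forall fun x => ?_)
  simp only [id, Real.norm_eq_abs, Even.pow_abs (by decide : Even 4)]
  ring

lemma integral_sq_gaussian : ∫ x, x ^ 2 ∂(gaussianReal 0 1) = 1 := by
  have h := variance_eq_sub (memLp_id_gaussianReal (μ := 0) (v := 1) 2)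
  rw [variance_id_gaussianReal] at h
  simpa using h.symm

/-- Rejecting for a large empirical variance detects centred signals of squared norm of order
`(1 - γ) √p`, whatever their sparsity. -/
theorem exists_dense_test {η : ℝ} (hη : 0 < η) : ∃ M : ℝ, 0 < M ∧
    ∀ (p s : ℕ) (γ ε : ℝ), 1 ≤ p → 0 ≤ γ → γ < 1 → 0 ≤ ε → M * ((1 - γ) * √p) ≤ ε ^ 2 →
      minimaxRisk p s γ ε ≤ ENNReal.ofReal η := by
  set v := Var[fun x : ℝ => x ^ 2; gaussianReal 0 1] with hv
  have hv0 : 0 ≤ v := variance_nonneg _ _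
  -- Chebyshev's inequality at `t` standard deviations: each of the four error terms is at most
  -- `η / 4`.
  set t := 1 + 4 * (v + 1) / η with ht
  have htη : 4 * (v + 1) / η ≤ t := by linarith
  have ht1 : 1 ≤ t := by
    have : 0 ≤ 4 * (v + 1) / η := by positivity
    linarith
  have ht0 : 0 < t := by linarith
  have htt : 4 * (v + 1) ≤ η * t ^ 2 := by
    rw [div_le_iff₀ hη] at htη
    nlinarith
  have hb1 : v / t ^ 2 ≤ η / 4 := by
    rw [div_le_iff₀ (by positivity)]; linarith
  have hb2 : 1 / t ^ 2 ≤ η / 4 := by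
    rw [div_le_iff₀ (by positivity)]; linarith
  refine ⟨10 * t ^ 2, by positivity, fun p s γ ε hp h0 h1 hε hM => ?_⟩
  have hp1 : (1 : ℝ) ≤ p := by exact_mod_cast hp
  set r := √(p : ℝ) with hr
  have hr2 : r ^ 2 = p := Real.sq_sqrt (by linarith)
  have hr1 : 1 ≤ r := Real.one_le_sqrt.2 hp1
  -- The three fluctuations: of `∑ zᵢ²`, of `∑ zᵢ` and of a linear form in the noise.
  have hsq : noise p {z | t * r ≤ |∑ i, z i ^ 2 - p|} ≤ ENNReal.ofReal (η / 4) := by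
    have h := noise_deviation_le (p := p) (f := fun _ x => x ^ 2) (fun _ => memLp_sq_gaussian)
      (t := t * r) (by positivity)
    simp only [integral_sq_gaussian, ← hv, Finset.sum_const, Finset.card_univ, Fintype.card_fin,
      nsmul_eq_mul, mul_one] at h
    refine h.trans (ENNReal.ofReal_le_ofReal (le_trans (le_of_eq ?_) hb1))
    rw [mul_pow, hr2]
    field_simp
  have hlin : ∀ u : Fin p → ℝ, 0 < ∑ i, u i ^ 2 →
      noise p {z | t * √(∑ i, u i ^ 2) ≤ |∑ i, u i * z i|} ≤ ENNReal.ofReal (η / 4) := by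
    intro u hu
    have h := noise_deviation_le (p := p) (f := fun i x => u i * id x)
      (fun i => (memLp_id_gaussianReal 2).const_mul _) (t := t * √(∑ i, u i ^ 2)) (by positivity)
    simp only [integral_const_mul, variance_const_mul, variance_id_gaussianReal] at h
    simp only [id, integral_id_gaussianReal, mul_zero,
      Finset.sum_const_zero, sub_zero, NNReal.coe_one, mul_one] at h
    refine h.trans (ENNReal.ofReal_le_ofReal (le_trans (le_of_eq ?_) hb2))
    rw [mul_pow, Real.sq_sqrt hu.le]
    field_simp
  have hsum : noise p {z | t * r ≤ |∑ i, z i|} ≤ ENNReal.ofReal (η / 4) := by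
    simpa using hlin (fun _ => 1) (by simp; omega)
  have hsplit : ENNReal.ofReal η = ENNReal.ofReal (η / 4) +
      (ENNReal.ofReal (η / 4) + ENNReal.ofReal (η / 4) + ENNReal.ofReal (η / 4)) := by
    rw [← ENNReal.ofReal_add, ← ENNReal.ofReal_add, ← ENNReal.ofReal_add] <;> first
      | positivity
      | (congr 1; ring)
  rw [hsplit]
  refine minimaxRisk_le_of_shiftInvariant h0 h1 hε
    (R := {y | p + t * r < ∑ i, (y i - (∑ j, y j) / p) ^ 2})
    (measurableSet_lt measurable_const (by fun_prop)) ?_ ?_ ?_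
  · intro y c
    have : ∀ i, y i + c - (∑ j, (y j + c)) / p = y i - (∑ j, y j) / p := by
      intro i
      rw [Finset.sum_add_distrib]
      simp
      field_simp
      ring
    simp only [Set.mem_ofPred_eq, this]
  · refine (measure_mono fun z hz => ?_).trans hsq
    simp only [Set.mem_ofPred_eq, sum_sub_avg_sq] at hz ⊢
    have : 0 ≤ (∑ i, z i) ^ 2 / p := by positivity
    exact le_trans (by linarith) (le_abs_self _)
  · intro ϑ _ hϑ
    set u : Fin p → ℝ := fun i => ϑ i - (∑ j, ϑ j) / p with hu
    have hm : 10 * t ^ 2 * r ≤ ∑ i, u i ^ 2 := by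
      refine le_of_mul_le_mul_left ?_ (by linarith : 0 < 1 - γ)
      linarith
    have hm0 : 0 < ∑ i, u i ^ 2 := lt_of_lt_of_le (by positivity) hm
    refine (measure_mono fun z hz => ?_).trans ((measure_union_le _ _).trans
      (add_le_add ((measure_union_le _ _).trans (add_le_add hsq hsum)) (hlin u hm0)))
    by_contra hcon
    simp only [Set.mem_union, Set.mem_ofPred_eq, not_or, not_le] at hcon
    obtain ⟨⟨hc1, hc2⟩, hc3⟩ := hcon
    refine hz ?_
    simp only [Set.mem_ofPred_eq, sum_signal_add_noise_sub_avg_sq]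
    set m := √(∑ i, u i ^ 2) with hmdef
    have hm2 : m ^ 2 = ∑ i, u i ^ 2 := Real.sq_sqrt hm0.le
    have hc2' : (∑ i, z i) ^ 2 / p ≤ t ^ 2 := by
      rw [div_le_iff₀ (by linarith), ← hr2, ← mul_pow]
      exact sq_le_sq' (by linarith [(abs_lt.1 hc2).1]) (abs_lt.1 hc2).2.le
    have hc1' := (abs_lt.1 hc1).1
    have hc3' := (abs_lt.1 hc3).1
    change _ < ∑ i, u i ^ 2 + 2 * ∑ i, u i * z i + _
    have hA : 2 * (t * m) ≤ m ^ 2 / 2 + 2 * t ^ 2 := by nlinarith [sq_nonneg (m - 2 * t)]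
    have hB : t ^ 2 ≤ t ^ 2 * r := le_mul_of_one_le_right (by positivity) hr1
    have hC : t * r ≤ t ^ 2 * r :=
      mul_le_mul_of_nonneg_right (le_self_pow₀ ht1 two_ne_zero) (by linarith)
    linarith

/-! ### The test based on exponential moments -/

/-- A lower bound of the exponential by a function that is affine in `y ^ 2` and negative for
`y < y₀`; being affine in `y ^ 2`, it can be summed knowing only the Euclidean norm. -/
lemma exp_mul_sq_sub_one_le {y y₀ : ℝ} (hy : 0 ≤ y) (hy₀ : 2 ≤ y₀) :
    Real.exp y₀ * (y ^ 2 / y₀ ^ 2 - 1) ≤ Real.exp y := by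
  have h0 : 0 < y₀ := by linarith
  rcases le_total y y₀ with h | h
  · have : y ^ 2 / y₀ ^ 2 ≤ 1 := (div_le_one (by positivity)).2 (pow_le_pow_left₀ hy h 2)
    exact le_trans (mul_nonpos_of_nonneg_of_nonpos (Real.exp_pos _).le (by linarith))
      (Real.exp_pos _).le
  · have h1 : y / y₀ ≤ Real.exp ((y - y₀) / 2) := by
      have h2 : (y - y₀) / y₀ ≤ (y - y₀) / 2 :=
        div_le_div_of_nonneg_left (by linarith) (by norm_num) hy₀
      have h3 : y / y₀ = (y - y₀) / y₀ + 1 := by field_simp; ring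
      linarith [Real.add_one_le_exp ((y - y₀) / 2)]
    have h4 : (y / y₀) ^ 2 ≤ Real.exp (y - y₀) := by
      calc (y / y₀) ^ 2 ≤ Real.exp ((y - y₀) / 2) ^ 2 := pow_le_pow_left₀ (by positivity) h1 2
        _ = Real.exp (y - y₀) := by rw [← Real.exp_nat_mul]; congr 1; push_cast; ring
    calc Real.exp y₀ * (y ^ 2 / y₀ ^ 2 - 1) ≤ Real.exp y₀ * Real.exp (y - y₀) := by
          rw [← div_pow]
          exact mul_le_mul_of_nonneg_left (by linarith) (Real.exp_pos _).le
      _ = Real.exp y := by rw [← Real.exp_add]; congr 1; ring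

/-- Among sparse signals with a given Euclidean norm, the exponential weight is at least, up to
constants, that of a signal spread evenly over `s` coordinates. -/
lemma mul_exp_le_sum_exp_abs {ι : Type*} (S : Finset ι) (y : ι → ℝ) {s y₀ : ℝ}
    (hS : (S.card : ℝ) ≤ s) (hy₀ : 2 ≤ y₀) (hsum : 2 * s * y₀ ^ 2 ≤ ∑ i ∈ S, y i ^ 2) :
    s * Real.exp y₀ ≤ ∑ i ∈ S, Real.exp |y i| := by
  have h1 : ∑ i ∈ S, Real.exp y₀ * (|y i| ^ 2 / y₀ ^ 2 - 1) ≤ ∑ i ∈ S, Real.exp |y i| :=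
    Finset.sum_le_sum fun i _ => exp_mul_sq_sub_one_le (abs_nonneg _) hy₀
  refine le_trans ?_ h1
  rw [← Finset.mul_sum, Finset.sum_sub_distrib, ← Finset.sum_div, mul_comm]
  simp only [sq_abs, Finset.sum_const, nsmul_eq_mul, mul_one]
  refine mul_le_mul_of_nonneg_left ?_ (Real.exp_pos _).le
  have : 2 * s ≤ (∑ i ∈ S, y i ^ 2) / y₀ ^ 2 := by rwa [le_div_iff₀ (by positivity)]
  linarith

/-- The two exponential sums of opposite signs add up to at least the exponential weight of the
signal over the coordinates whose noise is moderate. -/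
lemma exp_neg_mul_sum_le_add {ι : Type*} (S : Finset ι) (x z : ι → ℝ) {l K : ℝ} (hl : 0 ≤ l) :
    Real.exp (-(l * K) - l ^ 2 / 2) *
        (∑ i ∈ S, Real.exp |l * x i| -
          ∑ i ∈ S, Real.exp |l * x i| * ({w : ℝ | K ≤ |w|}.indicator 1 (z i))) ≤
      ∑ i ∈ S, Real.exp (l * (x i + z i) - l ^ 2 / 2) +
        ∑ i ∈ S, Real.exp (-l * (x i + z i) - (-l) ^ 2 / 2) := by
  rw [← Finset.sum_sub_distrib, ← Finset.sum_add_distrib, Finset.mul_sum]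
  refine Finset.sum_le_sum fun i _ => ?_
  by_cases h : K ≤ |z i|
  · rw [Set.indicator_of_mem (by exact h)]
    simp only [Pi.one_apply, mul_one, sub_self, mul_zero]
    positivity
  · rw [Set.indicator_of_notMem (by exact h), mul_zero, sub_zero, ← Real.exp_add]
    have hz : |l * x i| - l * K ≤ |l * (x i + z i)| := by
      have h1 : |l * x i| ≤ |l * (x i + z i)| + |l * z i| := by
        calc |l * x i| = |l * (x i + z i) - l * z i| := by congr 1; ring
          _ ≤ _ := abs_sub _ _
      have h2 : |l * z i| ≤ l * K := by
        rw [abs_mul, abs_of_nonneg hl]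
        exact mul_le_mul_of_nonneg_left (not_le.1 h).le hl
      linarith
    have h3 : Real.exp (-(l * K) - l ^ 2 / 2 + |l * x i|) ≤
        Real.exp (|l * (x i + z i)| - l ^ 2 / 2) := Real.exp_le_exp.2 (by linarith)
    refine h3.trans ?_
    rcases abs_cases (l * (x i + z i)) with ⟨h4, _⟩ | ⟨h4, _⟩
    · rw [h4]
      exact le_add_of_nonneg_right (Real.exp_pos _).le
    · rw [h4, ← neg_mul, neg_sq]
      exact le_add_of_nonneg_left (Real.exp_pos _).le

/-- Deterministic separation of the product statistic: `a₀, b₀` are the contributions of the pure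
noise coordinates and `a₁, b₁` those of the signal coordinates. -/
lemma sq_lt_mul_of_le_add {p s t a₀ b₀ a₁ b₁ : ℝ} (hs : 0 < s) (ht : 0 ≤ t) (hp : 0 < p)
    (hq : p / 2 ≤ p - s - t) (ha₀ : p - s - t ≤ a₀) (hb₀ : p - s - t ≤ b₀) (ha₁ : 0 ≤ a₁)
    (hb₁ : 0 ≤ b₁) (h : 4 * (2 * t + s) ≤ a₁ + b₁) :
    (p + t) ^ 2 < (a₀ + a₁) * (b₀ + b₁) := by
  have h1 : (p - s - t) * (p - s - t) ≤ a₀ * b₀ := mul_le_mul ha₀ hb₀ (by linarith) (by linarith)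
  have h2 : p / 2 * b₁ ≤ a₀ * b₁ := mul_le_mul_of_nonneg_right (by linarith) hb₁
  have h3 : p / 2 * a₁ ≤ b₀ * a₁ := mul_le_mul_of_nonneg_right (by linarith) ha₁
  have h4 : 0 ≤ a₁ * b₁ := by positivity
  have h5 : p / 2 * (4 * (2 * t + s)) ≤ p / 2 * (a₁ + b₁) :=
    mul_le_mul_of_nonneg_left h (half_pos hp).le
  have h6 : 0 < s * (2 * t + s) := by positivity
  nlinarith

/-- Numerical part of the power of the exponential test: with `D` large the even signal beats the
fluctuations. -/
lemma sparse_signal_dominates {p s K L l t D : ℝ} (hs : 0 < s) (hK : 1 ≤ K)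
    (hL : 1 / 2 ≤ L) (hl : l ^ 2 = L / 2) (hpL : √p ≤ s * Real.exp (L / 2))
    (ht : t = K * √p * Real.exp (l ^ 2 / 2)) (hD : D = 49 * K + 2) :
    4 * (2 * t + s) ≤ Real.exp (-(l * K) - l ^ 2 / 2) * (s * Real.exp (D * L) / 2) := by
  have hlL : l ≤ L := abs_le_of_sq_le_sq' (by nlinarith) (by linarith) |>.2
  have ht' : t ≤ K * s * Real.exp L := by
    rw [ht, hl]
    calc K * √p * Real.exp (L / 2 / 2)
        ≤ K * (s * Real.exp (L / 2)) * Real.exp (L / 2) := by gcongr; linarith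
      _ = K * s * Real.exp L := by
        rw [show L = L / 2 + L / 2 by ring, Real.exp_add]; ring_nf
  have hs' : s ≤ K * s * Real.exp L := by
    have h1 : 1 ≤ Real.exp L := Real.one_le_exp (by linarith)
    nlinarith [mul_le_mul hK h1 zero_le_one (by linarith)]
  have hexp : 24 * K ≤ Real.exp (48 * K * L) := by
    have h1 := Real.add_one_le_exp (48 * K * L)
    nlinarith
  have hlow : Real.exp L * Real.exp (48 * K * L) ≤
      Real.exp (-(l * K) - l ^ 2 / 2) * Real.exp (D * L) := by
    rw [← Real.exp_add, ← Real.exp_add, hl, hD]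
    refine Real.exp_le_exp.2 ?_
    nlinarith [mul_le_mul_of_nonneg_right hlL (by linarith : 0 ≤ K)]
  have h2 : Real.exp L * (24 * K) ≤ Real.exp L * Real.exp (48 * K * L) := by gcongr
  calc 4 * (2 * t + s) ≤ s / 2 * (Real.exp L * (24 * K)) := by linarith
    _ ≤ s / 2 * (Real.exp (-(l * K) - l ^ 2 / 2) * Real.exp (D * L)) := by
      exact mul_le_mul_of_nonneg_left (h2.trans hlow) (by linarith)
    _ = _ := by ring

/-- The normalized exponential sum `∑ᵢ exp (l yᵢ - l² / 2)`, of mean `p` under standard noise. -/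
noncomputable def expSum {p : ℕ} (l : ℝ) (y : Fin p → ℝ) : ℝ := ∑ i, Real.exp (l * y i - l ^ 2 / 2)

lemma expSum_nonneg {p : ℕ} (l : ℝ) (y : Fin p → ℝ) : 0 ≤ expSum l y :=
  Finset.sum_nonneg fun _ _ => (Real.exp_pos _).le

lemma expSum_add_const {p : ℕ} (l : ℝ) (y : Fin p → ℝ) (c : ℝ) :
    expSum l (fun i => y i + c) = expSum l y * Real.exp (l * c) := by
  unfold expSum
  rw [Finset.sum_mul]
  refine Finset.sum_congr rfl fun i _ => ?_
  rw [← Real.exp_add]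
  congr 1
  ring

lemma expSum_mul_expSum_neg_add_const {p : ℕ} (l : ℝ) (y : Fin p → ℝ) (c : ℝ) :
    expSum l (fun i => y i + c) * expSum (-l) (fun i => y i + c) = expSum l y * expSum (-l) y := by
  rw [expSum_add_const, expSum_add_const, mul_mul_mul_comm, ← Real.exp_add, neg_mul,
    add_neg_cancel, Real.exp_zero, mul_one]

lemma measurable_expSum {p : ℕ} (l : ℝ) : Measurable (expSum (p := p) l) := by
  unfold expSum
  fun_prop

/-- Type I error of the exponential product test. -/
lemma noise_expSum_product_level {p : ℕ} {l t : ℝ} (ht : 0 < t) :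
    noise p {z | ((p : ℝ) + t) ^ 2 < expSum l z * expSum (-l) z} ≤
      ENNReal.ofReal (p * Real.exp (l ^ 2) / t ^ 2) +
        ENNReal.ofReal (p * Real.exp (l ^ 2) / t ^ 2) := by
  have hdev1 := noise_exp_deviation_le (p := p) Finset.univ l ht
  have hdev2 := noise_exp_deviation_le (p := p) Finset.univ (-l) ht
  rw [neg_sq] at hdev2
  refine (measure_mono fun z hz => ?_).trans ((measure_union_le _ _).trans
    (add_le_add hdev1 hdev2))
  by_contra hcon
  simp only [Set.mem_union, Set.mem_ofPred_eq, not_or, not_le, Finset.card_univ,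
    Fintype.card_fin] at hcon hz
  have h1 : expSum l z ≤ p + t := by
    unfold expSum
    linarith [(abs_lt.1 hcon.1).2]
  have h2 : expSum (-l) z ≤ p + t := by
    unfold expSum
    rw [neg_sq]
    linarith [(abs_lt.1 hcon.2).2]
  have h3 := mul_le_mul h1 h2 (expSum_nonneg _ _) (by positivity)
  rw [← sq] at h3
  exact absurd hz (not_lt.2 h3)

/-- Type II error of the exponential product test at a signal `x` of large exponential weight `w`.
The coordinates outside the support concentrate by Chebyshev's inequality, those in the support
keep half of their weight. -/
lemma noise_expSum_product_power {p : ℕ} (x : Fin p → ℝ) {s l t K w : ℝ} (hs : 0 < s) (ht : 0 < t)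
    (hK : 0 < K) (hl : 0 ≤ l) (hq : p / 2 ≤ p - s - t)
    (hcard : ((Finset.univ.filter fun i => x i ≠ 0).card : ℝ) ≤ s) (hw0 : 0 < w)
    (hw : w ≤ ∑ i ∈ Finset.univ.filter fun i => x i ≠ 0, Real.exp |l * x i|)
    (hdom : 4 * (2 * t + s) ≤ Real.exp (-(l * K) - l ^ 2 / 2) * (w / 2)) :
    noise p {z | ¬ ((p : ℝ) + t) ^ 2 < expSum l (fun i => x i + z i) *
      expSum (-l) (fun i => x i + z i)} ≤
      ENNReal.ofReal (p * Real.exp (l ^ 2) / t ^ 2) +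
        ENNReal.ofReal (p * Real.exp (l ^ 2) / t ^ 2) + ENNReal.ofReal (2 / K ^ 2) := by
  classical
  set S := Finset.univ.filter fun i => x i ≠ 0 with hS
  have hSne : S.Nonempty := by
    rw [Finset.nonempty_iff_ne_empty]
    intro hempty
    rw [hempty, Finset.sum_empty] at hw
    linarith
  have hScompl : ((Sᶜ).card : ℝ) = p - S.card := by
    rw [Finset.card_compl, Fintype.card_fin, Nat.cast_sub]
    simpa using Finset.card_le_univ S
  have hdev1 := noise_exp_deviation_le Sᶜ l ht
  have hdev2 := noise_exp_deviation_le Sᶜ (-l) ht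
  rw [neg_sq] at hdev2
  refine (measure_mono fun z hz => ?_).trans ((measure_union_le _ _).trans (add_le_add
    ((measure_union_le _ _).trans (add_le_add hdev1 hdev2))
    (noise_lost_weight_le S (a := fun i => Real.exp |l * x i|) (fun i _ => Real.exp_pos _) hSne
      hK)))
  by_contra hcon
  simp only [Set.mem_union, Set.mem_ofPred_eq, not_or, not_le, hScompl] at hcon
  obtain ⟨⟨hc1, hc2⟩, hc3⟩ := hcon
  refine hz ?_
  have hnoise : ∀ l' : ℝ, expSum l' (fun i => x i + z i) =
      ∑ i ∈ Sᶜ, Real.exp (l' * z i - l' ^ 2 / 2) +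
        ∑ i ∈ S, Real.exp (l' * (x i + z i) - l' ^ 2 / 2) := by
    intro l'
    rw [expSum, ← Finset.sum_compl_add_sum S]
    congr 1
    refine Finset.sum_congr rfl fun i hi => ?_
    have : x i = 0 := by simpa [hS] using hi
    rw [this, zero_add]
  rw [hnoise, hnoise]
  have hp : (0 : ℝ) < p := by
    obtain ⟨i, -⟩ := hSne
    exact_mod_cast i.pos
  refine sq_lt_mul_of_le_add (s := s) hs ht.le hp hq (by linarith [(abs_lt.1 hc1).1])
    (by rw [neg_sq]; linarith [(abs_lt.1 hc2).1])
    (Finset.sum_nonneg fun i _ => (Real.exp_pos _).le)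
    (Finset.sum_nonneg fun i _ => (Real.exp_pos _).le) ?_
  refine hdom.trans (le_trans ?_ (exp_neg_mul_sum_le_add S x z (K := K) hl))
  refine mul_le_mul_of_nonneg_left ?_ (Real.exp_pos _).le
  linarith

/-- Size of the threshold of the exponential product test in high dimension. -/
lemma sparse_threshold_le {p s K E t : ℝ} (hs : 1 ≤ s) (hK : 1 ≤ K) (hp : 512 * K ^ 4 ≤ p)
    (hE : E ^ 2 = 1 + p / s ^ 2) (ht : t ^ 2 = K ^ 2 * p * E) : t ≤ p / 4 := by
  have hK4 : 1 ≤ K ^ 4 := one_le_pow₀ hK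
  have hp0 : 512 ≤ p := by linarith
  have h2 : E ^ 2 ≤ 2 * p := by
    have : p / s ^ 2 ≤ p := div_le_self (by linarith) (one_le_pow₀ hs)
    linarith
  have h3 : 16 * K ^ 2 * E ≤ p := by
    refine abs_le_of_sq_le_sq' ?_ (by linarith) |>.2
    calc (16 * K ^ 2 * E) ^ 2 = 256 * K ^ 4 * E ^ 2 := by ring
      _ ≤ 256 * K ^ 4 * (2 * p) := by gcongr
      _ = 512 * K ^ 4 * p := by ring
      _ ≤ p * p := by gcongr
      _ = p ^ 2 := by ring
  refine abs_le_of_sq_le_sq' ?_ (by linarith) |>.2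
  rw [ht]
  nlinarith

/-- A sparse vector with large centred norm has large exponential weight on its support. -/
lemma mul_exp_le_sum_exp_support {p : ℕ} (x : Fin p → ℝ) {s L l D : ℝ} (hl : l ^ 2 = L / 2)
    (hL : 0 ≤ L) (hDL : 2 ≤ D * L) (hcard : ((Finset.univ.filter fun i => x i ≠ 0).card : ℝ) ≤ s)
    (hx : 4 * D ^ 2 * (s * L) ≤ ∑ i, (x i - (∑ j, x j) / p) ^ 2) :
    s * Real.exp (D * L) ≤ ∑ i ∈ Finset.univ.filter fun i => x i ≠ 0, Real.exp |l * x i| := by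
  refine mul_exp_le_sum_exp_abs _ (fun i => l * x i) hcard hDL ?_
  have h3 : ∑ i ∈ Finset.univ.filter fun i => x i ≠ 0, x i ^ 2 = ∑ i, x i ^ 2 := by
    rw [Finset.sum_filter]
    refine Finset.sum_congr rfl fun i _ => ?_
    by_cases h : x i = 0 <;> simp [h]
  rw [sum_sub_avg_sq] at hx
  have h4 : 0 ≤ (∑ i, x i) ^ 2 / p := by positivity
  simp only [mul_pow]
  rw [← Finset.mul_sum, h3, hl]
  calc 2 * s * (D ^ 2 * L ^ 2) = L / 2 * (4 * D ^ 2 * (s * L)) := by ring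
    _ ≤ L / 2 * ∑ i, x i ^ 2 := mul_le_mul_of_nonneg_left (by linarith) (by linarith)

lemma log_two_le_log_one_add_div_sq {p s : ℝ} (hs : 0 < s) (h : s ^ 2 ≤ p) :
    Real.log 2 ≤ Real.log (1 + p / s ^ 2) := by
  refine Real.log_le_log (by norm_num) ?_
  have : 1 ≤ p / s ^ 2 := by rwa [le_div_iff₀ (by positivity), one_mul]
  linarith

/-- In high dimension, rejecting for a large value of
`(∑ᵢ exp (l yᵢ)) (∑ᵢ exp (-l yᵢ))` detects sparse signals at the sparse rate. -/
theorem exists_sparse_test {η : ℝ} (hη : 0 < η) : ∃ N M : ℝ, 0 < M ∧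
    ∀ (p s : ℕ) (γ ε : ℝ), N ≤ p → 1 ≤ s → (s : ℝ) < √p → 0 ≤ γ → γ < 1 → 0 ≤ ε →
      M * ((1 - γ) * s * Real.log (1 + p / (s : ℝ) ^ 2)) ≤ ε ^ 2 →
      minimaxRisk p s γ ε ≤ ENNReal.ofReal η := by
  -- The error terms add up to `6 / K ^ 2`.
  set K := 1 + 6 / η with hKdef
  have hK1 : 1 ≤ K := by
    have : 0 < 6 / η := by positivity
    linarith
  have hKη : 6 / K ^ 2 ≤ η := by
    have h1 : 6 / η ≤ K := by linarith
    rw [div_le_iff₀ hη] at h1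
    rw [div_le_iff₀ (by positivity)]
    nlinarith
  set D := 49 * K + 2 with hD
  refine ⟨512 * K ^ 4, 4 * D ^ 2, by positivity, fun p s γ ε hN hs hsp h0 h1 hε hM => ?_⟩
  set L := Real.log (1 + p / (s : ℝ) ^ 2) with hLdef
  set l := √(L / 2) with hldef
  have hs1 : (1 : ℝ) ≤ s := by exact_mod_cast hs
  have hK4 : 1 ≤ K ^ 4 := one_le_pow₀ hK1
  have hp : (512 : ℝ) ≤ p := by linarith
  set r := √(p : ℝ) with hr
  have hr2 : r ^ 2 = p := Real.sq_sqrt (by linarith)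
  have hs2p : (s : ℝ) ^ 2 ≤ p := by rw [← hr2]; exact pow_le_pow_left₀ (by linarith) hsp.le 2
  have hexpL : Real.exp L = 1 + p / (s : ℝ) ^ 2 := Real.exp_log (by positivity)
  have hL : 1 / 2 ≤ L := by
    linarith [Real.log_two_gt_d9, log_two_le_log_one_add_div_sq (by linarith) hs2p]
  have hDL : 2 ≤ D * L := by
    have h4 : 4 * (1 / 2) ≤ D * L :=
      mul_le_mul (by linarith) hL (by norm_num) (by linarith)
    linarith
  have hl2 : l ^ 2 = L / 2 := Real.sq_sqrt (by linarith)
  have hl0 : 0 ≤ l := Real.sqrt_nonneg _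
  -- `K` times the bound `√p exp (l ^ 2 / 2)` on the standard deviation of `expSum l` under noise.
  set t := K * r * Real.exp (l ^ 2 / 2) with ht
  have ht0 : 0 < t := by positivity
  -- The value of `l` is chosen so that `exp (l ^ 2) = √(1 + p / s ^ 2)`.
  have hE : Real.exp (l ^ 2) ^ 2 = 1 + p / (s : ℝ) ^ 2 := by
    rw [← Real.exp_nat_mul, hl2, ← hexpL]; congr 1; push_cast; ring
  have ht2 : t ^ 2 = K ^ 2 * p * Real.exp (l ^ 2) := by
    rw [ht, mul_pow, mul_pow, hr2, ← Real.exp_nat_mul]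
    congr 2
    push_cast
    ring
  have htp : t ≤ p / 4 := sparse_threshold_le hs1 hK1 hN hE ht2
  have hsp4 : (s : ℝ) ≤ p / 4 := by
    have : 4 ≤ r := Real.le_sqrt_of_sq_le (by linarith)
    nlinarith
  have hrs : r ≤ s * Real.exp (L / 2) := by
    refine abs_le_of_sq_le_sq' ?_ (by positivity) |>.2
    have h2 : Real.exp (L / 2) ^ 2 = 1 + p / (s : ℝ) ^ 2 := by
      rw [← hexpL, ← Real.exp_nat_mul]; congr 1; push_cast; ring
    rw [mul_pow, h2, hr2, mul_add, mul_div_cancel₀ _ (by positivity)]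
    linarith [sq_nonneg (s : ℝ)]
  have hratio : p * Real.exp (l ^ 2) / t ^ 2 = 1 / K ^ 2 := by
    rw [ht2]
    have : (p : ℝ) ≠ 0 := by linarith
    field_simp
  have hsplit : ENNReal.ofReal (1 / K ^ 2) + ENNReal.ofReal (1 / K ^ 2) +
      (ENNReal.ofReal (1 / K ^ 2) + ENNReal.ofReal (1 / K ^ 2) + ENNReal.ofReal (2 / K ^ 2)) ≤
      ENNReal.ofReal η := by
    rw [← ENNReal.ofReal_add, ← ENNReal.ofReal_add, ← ENNReal.ofReal_add] <;> try positivity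
    refine ENNReal.ofReal_le_ofReal (le_trans (le_of_eq ?_) hKη)
    ring
  refine le_trans ?_ hsplit
  refine minimaxRisk_le_of_shiftInvariant h0 h1 hε
    (R := {y | ((p : ℝ) + t) ^ 2 < expSum l y * expSum (-l) y})
    (measurableSet_lt measurable_const ((measurable_expSum l).mul (measurable_expSum (-l)))) ?_ ?_
    fun x hxs hx => ?_
  · intro y c
    simp only [Set.mem_ofPred_eq, expSum_mul_expSum_neg_add_const]
  · have h := noise_expSum_product_level (p := p) (l := l) ht0
    rwa [hratio] at h
  · have hSs : ((Finset.univ.filter fun i => x i ≠ 0).card : ℝ) ≤ s := by exact_mod_cast hxs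
    have hx' : 4 * D ^ 2 * (s * L) ≤ ∑ i, (x i - (∑ j, x j) / p) ^ 2 := by
      refine le_of_mul_le_mul_left ?_ (by linarith : 0 < 1 - γ)
      linarith
    have h := noise_expSum_product_power x (s := s) (K := K) (by linarith) ht0 (by linarith) hl0
      (by linarith) hSs (by positivity)
      (mul_exp_le_sum_exp_support x hl2 (by linarith) hDL hSs hx')
      (sparse_signal_dominates (by linarith) hK1 hL hl2 hrs ht hD)
    rwa [hratio] at h

/-! ### The upper bound -/

lemma psiSq_pos {p s : ℕ} {γ : ℝ} (h : Config p s γ) : 0 < psiSq p s γ := by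
  obtain ⟨hp, hs, -, -, h1⟩ := h
  have hs' : (0 : ℝ) < s := by exact_mod_cast hs
  have hp' : (0 : ℝ) < p := by exact_mod_cast (by omega : 0 < p)
  have h1' : 0 < 1 - γ := by linarith
  unfold psiSq
  split_ifs
  · have : 0 < Real.log (1 + p / (s : ℝ) ^ 2) := Real.log_pos (by
      have : 0 < (p : ℝ) / (s : ℝ) ^ 2 := by positivity
      linarith)
    positivity
  · positivity

/-- In dimension at most `N`, which depends on `η` only, the dense test also covers the sparse
regime, since there `√p` and `s log (1 + p / s²)` are comparable. -/
theorem exists_upper_const {η : ℝ} (hη : 0 < η) : ∃ Cη : ℝ, 0 < Cη ∧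
    ∀ (p s : ℕ) (γ : ℝ), Config p s γ → ∀ C : ℝ, Cη < C →
      minimaxRisk p s γ (C * √(psiSq p s γ)) ≤ ENNReal.ofReal η := by
  obtain ⟨N, M₁, hM₁, hsparse⟩ := exists_sparse_test hη
  obtain ⟨M₂, hM₂, hdense⟩ := exists_dense_test hη
  have hlog : 0 < Real.log 2 := Real.log_pos (by norm_num)
  refine ⟨1 + M₁ + M₂ + M₂ * √N / Real.log 2, by positivity, fun p s γ hcfg C hC => ?_⟩
  have hψ := psiSq_pos hcfg
  obtain ⟨hp, hs, -, h0, h1⟩ := hcfg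
  have h1' : 0 < 1 - γ := by linarith
  have hs1 : (1 : ℝ) ≤ s := by exact_mod_cast hs
  have hq : 0 ≤ M₂ * √N / Real.log 2 := by positivity
  have hCC : C ≤ C ^ 2 := le_self_pow₀ (by linarith) two_ne_zero
  have hε : 0 ≤ C * √(psiSq p s γ) := mul_nonneg (by linarith) (Real.sqrt_nonneg _)
  have hε2 : (C * √(psiSq p s γ)) ^ 2 = C ^ 2 * psiSq p s γ := by
    rw [mul_pow, Real.sq_sqrt hψ.le]
  rcases lt_or_ge (s : ℝ) √(p : ℝ) with hsp | hsp
  · have hψe : psiSq p s γ = (1 - γ) * s * Real.log (1 + p / (s : ℝ) ^ 2) := if_pos hsp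
    rcases le_or_gt N p with hN | hN
    · refine hsparse p s γ _ hN hs hsp h0 h1 hε ?_
      rw [hε2, ← hψe]
      exact mul_le_mul_of_nonneg_right (by linarith) hψ.le
    · refine hdense p s γ _ (by omega) h0 h1 hε ?_
      have hs2 : (s : ℝ) ^ 2 ≤ p := by
        rw [← Real.sq_sqrt (Nat.cast_nonneg p)]
        exact pow_le_pow_left₀ (by linarith) hsp.le 2
      have hL : Real.log 2 ≤ Real.log (1 + p / (s : ℝ) ^ 2) :=
        log_two_le_log_one_add_div_sq (by linarith) hs2
      have hrN : √(p : ℝ) ≤ √N := Real.sqrt_le_sqrt hN.le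
      have h2 : M₂ * √N ≤ C ^ 2 * Real.log 2 := by
        rw [← div_le_iff₀ hlog]
        linarith
      have h3 : Real.log 2 ≤ s * Real.log (1 + p / (s : ℝ) ^ 2) := by
        calc Real.log 2 = 1 * Real.log 2 := (one_mul _).symm
          _ ≤ _ := mul_le_mul hs1 hL hlog.le (by linarith)
      rw [hε2, hψe]
      calc M₂ * ((1 - γ) * √p) = (1 - γ) * (M₂ * √p) := by ring
        _ ≤ (1 - γ) * (M₂ * √N) := by gcongr
        _ ≤ (1 - γ) * (C ^ 2 * Real.log 2) := by gcongr
        _ ≤ (1 - γ) * (C ^ 2 * (s * Real.log (1 + p / (s : ℝ) ^ 2))) := by gcongr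
        _ = _ := by ring
  · have hψe : psiSq p s γ = (1 - γ) * √p := if_neg (not_lt.2 hsp)
    refine hdense p s γ _ (by omega) h0 h1 hε ?_
    rw [hε2, ← hψe]
    exact mul_le_mul_of_nonneg_right (by linarith) hψ.le

/-! ### Likelihood ratios and the second moment method -/

/-- The likelihood ratio of `N(u, Iₚ)` with respect to `N(0, Iₚ)`. -/
noncomputable def likelihoodRatio {p : ℕ} (u z : Fin p → ℝ) : ℝ :=
  ∏ i, Real.exp (u i * z i - u i ^ 2 / 2)

lemma likelihoodRatio_nonneg {p : ℕ} (u z : Fin p → ℝ) : 0 ≤ likelihoodRatio u z :=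
  Finset.prod_nonneg fun _ _ => (Real.exp_pos _).le

lemma measurable_likelihoodRatio {p : ℕ} (u : Fin p → ℝ) : Measurable (likelihoodRatio u) := by
  unfold likelihoodRatio
  fun_prop

lemma integrable_likelihoodRatio {p : ℕ} (u : Fin p → ℝ) :
    Integrable (likelihoodRatio u) (noise p) :=
  Integrable.fintype_prod (f := fun i x => Real.exp (u i * x - u i ^ 2 / 2))
    fun i => (memLp_exp_gaussian (u i)).integrable one_le_two

lemma integral_likelihoodRatio {p : ℕ} (u : Fin p → ℝ) :
    ∫ z, likelihoodRatio u z ∂(noise p) = 1 := by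
  have h := integral_fintype_prod_eq_prod (μ := fun _ : Fin p => gaussianReal 0 1)
    (fun i x => Real.exp (u i * x - u i ^ 2 / 2))
  simpa [likelihoodRatio, integral_exp_gaussian] using h

lemma likelihoodRatio_mul {p : ℕ} (u v z : Fin p → ℝ) :
    likelihoodRatio u z * likelihoodRatio v z =
      Real.exp (∑ i, u i * v i) * likelihoodRatio (u + v) z := by
  rw [likelihoodRatio, likelihoodRatio, likelihoodRatio, Real.exp_sum, ← Finset.prod_mul_distrib,
    ← Finset.prod_mul_distrib]
  refine Finset.prod_congr rfl fun i _ => ?_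
  rw [← Real.exp_add, ← Real.exp_add, Pi.add_apply]
  congr 1
  ring

lemma gaussianReal_eq_withDensity (m : ℝ) :
    gaussianReal m 1 = (gaussianReal 0 1).withDensity
      fun x => ENNReal.ofReal (Real.exp (m * x - m ^ 2 / 2)) := by
  rw [gaussianReal_of_var_ne_zero _ one_ne_zero, gaussianReal_of_var_ne_zero _ one_ne_zero,
    ← withDensity_mul _ (measurable_gaussianPDF _ _) (by fun_prop)]
  congr 1
  funext x
  rw [Pi.mul_apply, gaussianPDF, gaussianPDF, ← ENNReal.ofReal_mul (gaussianPDFReal_nonneg _ _ _),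
    gaussianPDFReal, gaussianPDFReal, mul_assoc (√_)⁻¹, ← Real.exp_add]
  congr 3
  simp
  ring

/-- Cameron–Martin formula: translating the noise by `u` multiplies its law by the likelihood
ratio. -/
lemma noise_translate {p : ℕ} (u : Fin p → ℝ) {E : Set (Fin p → ℝ)} (hE : MeasurableSet E) :
    noise p {z | (fun i => u i + z i) ∈ E} =
      ∫⁻ z in E, ENNReal.ofReal (likelihoodRatio u z) ∂(noise p) := by
  have hmap : (noise p).map (fun z i => u i + z i) = Measure.pi fun i => gaussianReal (u i) 1 := by
    have hi : ∀ i, (gaussianReal 0 1).map (fun x => u i + x) = gaussianReal (u i) 1 := by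
      intro i
      rw [gaussianReal_map_const_add, zero_add]
    have hprob : ∀ i, IsProbabilityMeasure ((gaussianReal 0 1).map (fun x => u i + x)) := by
      intro i
      rw [hi]
      infer_instance
    rw [noise, Measure.pi_map_pi (f := fun i x => u i + x) fun i => by fun_prop]
    simp only [hi]
  have hdens : (Measure.pi fun i => gaussianReal (u i) 1) =
      (noise p).withDensity fun z => ENNReal.ofReal (likelihoodRatio u z) := by
    refine Measure.pi_eq fun s hs => ?_
    rw [withDensity_apply _ (MeasurableSet.univ_pi hs), ← lintegral_indicator
      (MeasurableSet.univ_pi hs)]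
    set F : Fin p → ℝ → ℝ≥0∞ := fun i =>
      (s i).indicator fun x => ENNReal.ofReal (Real.exp (u i * x - u i ^ 2 / 2)) with hF
    have hFm : ∀ i, Measurable (F i) := fun i =>
      Measurable.indicator (by fun_prop) (hs i)
    have hprod : ∀ z : Fin p → ℝ, (Set.univ.pi s).indicator
        (fun z => ENNReal.ofReal (likelihoodRatio u z)) z = ∏ i, F i (z i) := by
      intro z
      by_cases hz : z ∈ Set.univ.pi s
      · rw [Set.indicator_of_mem hz, likelihoodRatio,
          ENNReal.ofReal_prod_of_nonneg fun i _ => (Real.exp_pos _).le]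
        refine Finset.prod_congr rfl fun i _ => ?_
        simp only [hF]
        rw [Set.indicator_of_mem (hz i (Set.mem_univ i))]
      · rw [Set.indicator_of_notMem hz]
        obtain ⟨i, hi⟩ : ∃ i, z i ∉ s i := by simpa [Set.mem_pi] using hz
        exact (Finset.prod_eq_zero (Finset.mem_univ i) (Set.indicator_of_notMem hi _)).symm
    simp only [hprod]
    rw [lintegral_prod_eq_prod_lintegral_of_indepFun Finset.univ
      (fun i (z : Fin p → ℝ) => F i (z i))
      (iIndepFun_pi fun i => (hFm i).aemeasurable) fun i => (hFm i).comp (measurable_pi_apply i)]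
    refine Finset.prod_congr rfl fun i _ => ?_
    rw [gaussianReal_eq_withDensity (u i), withDensity_apply _ (hs i), ← lintegral_indicator (hs i),
      ← (measurePreserving_eval (fun _ : Fin p => gaussianReal 0 1) i).lintegral_comp (hFm i)]
  have hm : Measurable fun (z : Fin p → ℝ) (i : Fin p) => u i + z i := by fun_prop
  rw [← withDensity_apply _ hE, ← hdens, ← hmap, Measure.map_apply hm hE]
  rfl

lemma measureReal_noise_translate {p : ℕ} (u : Fin p → ℝ) {E : Set (Fin p → ℝ)}
    (hE : MeasurableSet E) :
    (noise p).real {z | (fun i => u i + z i) ∈ E} =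
      ∫ z in E, likelihoodRatio u z ∂(noise p) := by
  rw [measureReal_def, noise_translate u hE, integral_eq_lintegral_of_nonneg_ae
    (Filter.Eventually.of_forall fun z => likelihoodRatio_nonneg u z)
    (measurable_likelihoodRatio u).aestronglyMeasurable]

/-- Second moment method: if the average likelihood ratio over a finite family of alternatives has
second moment at most `1 + η²`, no test against the uniform mixture has total error below
`1 - η`. -/
lemma one_sub_le_mixture_errors {p : ℕ} {F : Type*} [Fintype F] [Nonempty F]
    (u : F → Fin p → ℝ) {η : ℝ} (hη : 0 < η)
    (h : ∑ f, ∑ f', Real.exp (∑ i, u f i * u f' i) ≤ (1 + η ^ 2) * (Fintype.card F : ℝ) ^ 2)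
    {E : Set (Fin p → ℝ)} (hE : MeasurableSet E) :
    ENNReal.ofReal (1 - η) ≤ noise p E + (Fintype.card F : ℝ≥0∞)⁻¹ *
      ∑ f, noise p {z | (fun i => u f i + z i) ∉ E} := by
  set n := (Fintype.card F : ℝ) with hn
  have hn0 : 0 < n := Nat.cast_pos.2 Fintype.card_pos
  set Lbar : (Fin p → ℝ) → ℝ := fun z => n⁻¹ * ∑ f, likelihoodRatio (u f) z with hLbar
  have hint : Integrable Lbar (noise p) :=
    (integrable_finsetSum _ fun f _ => integrable_likelihoodRatio (u f)).const_mul _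
  have hmean : ∫ z, Lbar z ∂(noise p) = 1 := by
    rw [hLbar, integral_const_mul, integral_finsetSum _ fun f _ => integrable_likelihoodRatio (u f)]
    simp only [integral_likelihoodRatio, Finset.sum_const, Finset.card_univ, nsmul_eq_mul, mul_one]
    exact inv_mul_cancel₀ hn0.ne'
  have hsq : ∀ z, Lbar z ^ 2 = (n ^ 2)⁻¹ * ∑ f, ∑ f',
      Real.exp (∑ i, u f i * u f' i) * likelihoodRatio (u f + u f') z := by
    intro z
    simp only [← likelihoodRatio_mul]
    rw [hLbar, mul_pow, inv_pow, sq (∑ f, _), Finset.sum_mul_sum]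
  have hint2 : Integrable (fun z => Lbar z ^ 2) (noise p) := by
    simp only [hsq]
    exact (integrable_finsetSum _ fun f _ => integrable_finsetSum _ fun f' _ =>
      (integrable_likelihoodRatio _).const_mul _).const_mul _
  have hmean2 : ∫ z, Lbar z ^ 2 ∂(noise p) ≤ 1 + η ^ 2 := by
    simp only [hsq]
    rw [integral_const_mul, integral_finsetSum _ fun f _ => integrable_finsetSum _ fun f' _ =>
      (integrable_likelihoodRatio _).const_mul _]
    have : ∀ f, ∫ z, ∑ f', Real.exp (∑ i, u f i * u f' i) * likelihoodRatio (u f + u f') z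
        ∂(noise p) = ∑ f', Real.exp (∑ i, u f i * u f' i) := by
      intro f
      rw [integral_finsetSum _ fun f' _ => (integrable_likelihoodRatio _).const_mul _]
      simp only [integral_const_mul, integral_likelihoodRatio, mul_one]
    simp only [this]
    rw [inv_mul_le_iff₀ (by positivity)]
    linarith
  -- `1 - L ≤ (1 - L)² / (2 η) + η / 2` replaces the Cauchy–Schwarz inequality.
  have hkey : ∫ z in Eᶜ, (1 - Lbar z) ∂(noise p) ≤ η := by
    set G : (Fin p → ℝ) → ℝ := fun z => (1 - 2 * Lbar z + Lbar z ^ 2) / (2 * η) + η / 2 with hG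
    have hGi : Integrable G (noise p) :=
      ((((integrable_const 1).sub (hint.const_mul 2)).add hint2).div_const _).add
        (integrable_const _)
    have hG0 : ∀ z, 0 ≤ G z := by
      intro z
      have : 0 ≤ 1 - 2 * Lbar z + Lbar z ^ 2 := by nlinarith [sq_nonneg (1 - Lbar z)]
      positivity
    have hle : ∀ z, 1 - Lbar z ≤ G z := by
      intro z
      have : G z - (1 - Lbar z) = (1 - Lbar z - η) ^ 2 / (2 * η) := by
        rw [hG]
        field_simp
        ring
      have h0 : 0 ≤ (1 - Lbar z - η) ^ 2 / (2 * η) := by positivity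
      linarith
    calc ∫ z in Eᶜ, (1 - Lbar z) ∂(noise p) ≤ ∫ z in Eᶜ, G z ∂(noise p) :=
          integral_mono ((integrable_const 1).sub hint).integrableOn hGi.integrableOn hle
      _ ≤ ∫ z, G z ∂(noise p) := setIntegral_le_integral hGi (Filter.Eventually.of_forall hG0)
      _ = (1 - 2 * 1 + ∫ z, Lbar z ^ 2 ∂(noise p)) / (2 * η) + η / 2 := by
          rw [hG, integral_add, integral_div, integral_add, integral_sub, integral_const_mul, hmean]
          · simp
          · exact integrable_const 1
          · exact hint.const_mul 2
          · exact (integrable_const 1).sub (hint.const_mul 2)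
          · exact hint2
          · exact (((integrable_const 1).sub (hint.const_mul 2)).add hint2).div_const _
          · exact integrable_const _
      _ ≤ (1 - 2 * 1 + (1 + η ^ 2)) / (2 * η) + η / 2 := by gcongr
      _ = η := by field_simp; ring
  have hII : ∀ f, (noise p).real {z | (fun i => u f i + z i) ∉ E} =
      ∫ z in Eᶜ, likelihoodRatio (u f) z ∂(noise p) := fun f =>
    measureReal_noise_translate (u f) hE.compl
  have hsum : n⁻¹ * ∑ f, (noise p).real {z | (fun i => u f i + z i) ∉ E} =
      ∫ z in Eᶜ, Lbar z ∂(noise p) := by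
    rw [hLbar, integral_const_mul, integral_finsetSum _ fun f _ =>
      (integrable_likelihoodRatio (u f)).integrableOn]
    simp only [hII]
  have hsub : ∫ z in Eᶜ, (1 - Lbar z) ∂(noise p) =
      (noise p).real Eᶜ - ∫ z in Eᶜ, Lbar z ∂(noise p) := by
    rw [integral_sub (integrable_const 1).integrableOn hint.integrableOn]
    simp
  have hreal : 1 - η ≤ (noise p).real E +
      n⁻¹ * ∑ f, (noise p).real {z | (fun i => u f i + z i) ∉ E} := by
    rw [hsum]
    have := probReal_compl_eq_one_sub (μ := noise p) hE
    linarith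
  refine (ENNReal.ofReal_le_ofReal hreal).trans (le_of_eq ?_)
  rw [ENNReal.ofReal_add measureReal_nonneg (mul_nonneg (by positivity)
      (Finset.sum_nonneg fun _ _ => measureReal_nonneg)), ENNReal.ofReal_mul (by positivity),
    ENNReal.ofReal_sum_of_nonneg fun _ _ => measureReal_nonneg, ENNReal.ofReal_inv_of_pos hn0, hn,
    ENNReal.ofReal_natCast, ofReal_measureReal]
  congr 2
  exact Finset.sum_congr rfl fun f _ => ofReal_measureReal

/-- The second moment bound passes to the equicorrelated model: the common factor is independent of
the signal, so it suffices to condition on it. -/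
lemma le_minimaxRisk_of_secondMoment {p s : ℕ} {γ ε η : ℝ} (h0 : 0 ≤ γ) (h1 : γ < 1)
    {F : Type*} [Fintype F] [Nonempty F] (u : F → Fin p → ℝ) (hη : 0 < η)
    (h : ∑ f, ∑ f', Real.exp (∑ i, u f i * u f' i) ≤ (1 + η ^ 2) * (Fintype.card F : ℝ) ^ 2)
    (halt : ∀ f, WithLp.toLp 2 (fun i => √(1 - γ) * u f i) ∈ alternative p s ε) :
    ENNReal.ofReal (1 - η) ≤ minimaxRisk p s γ ε := by
  refine le_iInf₂ fun φ hφ => ?_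
  set θ : F → EuclideanSpace ℝ (Fin p) := fun f => WithLp.toLp 2 (fun i => √(1 - γ) * u f i)
    with hθ
  have hA : MeasurableSet {x | φ x = 1} := hφ (MeasurableSet.singleton 1)
  have hB : MeasurableSet {x | φ x = 0} := hφ (MeasurableSet.singleton 0)
  set c : ℝ≥0∞ := (Fintype.card F : ℝ≥0∞)⁻¹ with hc
  have hsup : c * ∑ f, law (θ f) γ {x | φ x = 0} ≤
      ⨆ θ ∈ alternative p s ε, law θ γ {x | φ x = 0} := by
    calc c * ∑ f, law (θ f) γ {x | φ x = 0}
        ≤ c * ∑ _f : F, ⨆ θ ∈ alternative p s ε, law θ γ {x | φ x = 0} := by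
          gcongr with f
          exact le_iSup₂ (f := fun θ (_ : θ ∈ alternative p s ε) => law θ γ {x | φ x = 0})
            (θ f) (halt f)
      _ = _ := by
          rw [Finset.sum_const, Finset.card_univ, nsmul_eq_mul, ← mul_assoc, hc,
            ENNReal.inv_mul_cancel (by simp) (by simp), one_mul]
  refine le_trans ?_ (add_le_add le_rfl hsup)
  have hmeas : ∀ (θ : EuclideanSpace ℝ (Fin p)) {B : Set (EuclideanSpace ℝ (Fin p))},
      MeasurableSet B → Measurable fun g => noise p {z | observe θ γ z g ∈ B} := fun θ _ hB =>
    measurable_measure_prodMk_right (measurable_observe θ γ hB)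
  simp only [law_apply _ h0 h1.le hA, law_apply _ h0 h1.le hB]
  rw [← lintegral_finsetSum _ fun f _ => hmeas (θ f) hB, ← lintegral_const_mul _
    (Finset.measurable_sum _ fun f _ => hmeas (θ f) hB), ← lintegral_add_left (hmeas 0 hA)]
  calc ENNReal.ofReal (1 - η) = ∫⁻ _g, ENNReal.ofReal (1 - η) ∂(gaussianReal 0 1) := by simp
    _ ≤ _ := lintegral_mono fun g => ?_
  have hEm : MeasurableSet {z : Fin p → ℝ | observe 0 γ z g ∈ {x | φ x = 1}} :=
    (measurable_observe 0 γ).comp measurable_prodMk_right hA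
  refine (one_sub_le_mixture_errors u hη h hEm).trans (le_of_eq ?_)
  congr 2
  refine Finset.sum_congr rfl fun f _ => ?_
  congr 1
  ext z
  have hobs : observe 0 γ (fun i => u f i + z i) g = observe (θ f) γ z g := by
    ext i
    simp only [observe_apply, hθ, PiLp.zero_apply]
    ring
  simp only [Set.mem_ofPred_eq, hobs]
  have h2 : ∀ a : Fin 2, ¬ a = 1 ↔ a = 0 := by decide
  exact h2 _

/-! ### Block priors and the lower bound -/

/-- The signal equal to `a` at one position `f j` in each of `k` disjoint blocks of `m` coordinates
of `Fin p`, and `0` elsewhere. -/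
noncomputable def blockSignal {p k m : ℕ} (e : Fin k × Fin m ↪ Fin p) (a : ℝ) (f : Fin k → Fin m)
    (i : Fin p) : ℝ :=
  ∑ j, if e (j, f j) = i then a else 0

lemma sum_blockSignal_mul {p k m : ℕ} (e : Fin k × Fin m ↪ Fin p) (a : ℝ) (f : Fin k → Fin m)
    (w : Fin p → ℝ) : ∑ i, blockSignal e a f i * w i = ∑ j, a * w (e (j, f j)) := by
  simp only [blockSignal, Finset.sum_mul, ite_mul, zero_mul]
  rw [Finset.sum_comm]
  simp

lemma blockSignal_apply_embedding {p k m : ℕ} (e : Fin k × Fin m ↪ Fin p) (a : ℝ)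
    (f : Fin k → Fin m) (j : Fin k) (r : Fin m) :
    blockSignal e a f (e (j, r)) = if f j = r then a else 0 := by
  simp only [blockSignal, e.injective.eq_iff, Prod.mk.injEq]
  rw [Finset.sum_eq_single j]
  · simp
  · intro b _ hb
    simp [hb]
  · simp

lemma sum_blockSignal_mul_blockSignal {p k m : ℕ} (e : Fin k × Fin m ↪ Fin p) (a : ℝ)
    (f f' : Fin k → Fin m) : ∑ i, blockSignal e a f i * blockSignal e a f' i =
      ∑ j, if f' j = f j then a ^ 2 else 0 := by
  rw [sum_blockSignal_mul]
  refine Finset.sum_congr rfl fun j _ => ?_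
  rw [blockSignal_apply_embedding, mul_ite, mul_zero, sq]

lemma sum_blockSignal {p k m : ℕ} (e : Fin k × Fin m ↪ Fin p) (a : ℝ) (f : Fin k → Fin m) :
    ∑ i, blockSignal e a f i = k * a := by
  simpa using sum_blockSignal_mul e a f fun _ => 1

lemma card_support_blockSignal_le {p k m : ℕ} (e : Fin k × Fin m ↪ Fin p) (a : ℝ)
    (f : Fin k → Fin m) : (Finset.univ.filter fun i => blockSignal e a f i ≠ 0).card ≤ k := by
  classical
  have h : (Finset.univ.filter fun i => blockSignal e a f i ≠ 0) ⊆
      Finset.univ.image fun j => e (j, f j) := by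
    intro i hi
    rw [Finset.mem_filter] at hi
    obtain ⟨j, -, hj⟩ := Finset.exists_ne_zero_of_sum_ne_zero hi.2
    exact Finset.mem_image.2 ⟨j, Finset.mem_univ _, by_contra fun hne => hj (if_neg hne)⟩
  exact (Finset.card_le_card h).trans (Finset.card_image_le.trans (by simp))

/-- The overlap of two independent block signals is a sum of independent indicators, so its
exponential moment factorizes. -/
lemma sum_exp_overlap (k m : ℕ) (b : ℝ) :
    ∑ f : Fin k → Fin m, ∑ f' : Fin k → Fin m, Real.exp (∑ j, if f' j = f j then b else 0) =
      ((m : ℝ) * (m + (Real.exp b - 1))) ^ k := by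
  have h1 : ∀ f : Fin k → Fin m,
      ∑ f' : Fin k → Fin m, Real.exp (∑ j, if f' j = f j then b else 0) =
        (m + (Real.exp b - 1)) ^ k := by
    intro f
    have h2 : ∀ q : Fin m, ∑ r : Fin m, Real.exp (if r = q then b else 0) =
        m + (Real.exp b - 1) := by
      intro q
      have h3 : ∀ r : Fin m, Real.exp (if r = q then b else 0) =
          1 + if r = q then Real.exp b - 1 else 0 := by
        intro r
        split_ifs <;> simp
      simp [h3, Finset.sum_add_distrib]
    simp only [Real.exp_sum]
    have h4 := Finset.prod_univ_sum (fun _ : Fin k => (Finset.univ : Finset (Fin m)))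
      (fun j r => Real.exp (if r = f j then b else 0))
    rw [Fintype.piFinset_univ] at h4
    rw [← h4]
    simp [h2]
  simp only [h1]
  simp [mul_pow]

/-- The chi-square bound for the block prior, with `m` positions in each of `k` blocks. -/
lemma sum_exp_blockSignal_le {p k m : ℕ} (e : Fin k × Fin m ↪ Fin p) (hm : 0 < m) {a τ : ℝ}
    (hτ : 0 ≤ τ) (h : k * (Real.exp (a ^ 2) - 1) / m ≤ Real.log (1 + τ)) :
    ∑ f : Fin k → Fin m, ∑ f' : Fin k → Fin m,
        Real.exp (∑ i, blockSignal e a f i * blockSignal e a f' i) ≤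
      (1 + τ) * (Fintype.card (Fin k → Fin m) : ℝ) ^ 2 := by
  have hm' : (0 : ℝ) < m := by exact_mod_cast hm
  simp only [sum_blockSignal_mul_blockSignal, sum_exp_overlap]
  have hcard : (Fintype.card (Fin k → Fin m) : ℝ) ^ 2 = ((m : ℝ) ^ 2) ^ k := by
    simp [← pow_mul, mul_comm]
  have hexp : 0 ≤ (Real.exp (a ^ 2) - 1) / m :=
    div_nonneg (by linarith [Real.one_le_exp (sq_nonneg a)]) hm'.le
  rw [hcard, show (m : ℝ) * (m + (Real.exp (a ^ 2) - 1)) =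
    (1 + (Real.exp (a ^ 2) - 1) / m) * (m : ℝ) ^ 2 by field_simp, mul_pow]
  refine mul_le_mul_of_nonneg_right ?_ (by positivity)
  calc (1 + (Real.exp (a ^ 2) - 1) / m) ^ k ≤ Real.exp ((Real.exp (a ^ 2) - 1) / m) ^ k :=
        pow_le_pow_left₀ (by linarith) (by
          rw [add_comm]; exact Real.add_one_le_exp _) k
    _ = Real.exp (k * (Real.exp (a ^ 2) - 1) / m) := by
        rw [← Real.exp_nat_mul]; congr 1; ring
    _ ≤ Real.exp (Real.log (1 + τ)) := Real.exp_le_exp.2 h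
    _ = 1 + τ := Real.exp_log (by linarith)

/-- Signals of height `a √(1 - γ)` at `k ≤ p / 2` positions cannot be detected while
`k² (exp (a²) - 1) / p` is small. -/
lemma le_minimaxRisk_of_block {p s k : ℕ} {γ ε η a : ℝ} (h0 : 0 ≤ γ) (h1 : γ < 1) (hη : 0 < η)
    (hk : 1 ≤ k) (hks : k ≤ s) (hkp : 2 * k ≤ p)
    (hε : ε ^ 2 ≤ (1 - γ) * (k * a ^ 2 / 2))
    (hchi : 2 * (k : ℝ) ^ 2 * (Real.exp (a ^ 2) - 1) / p ≤ Real.log (1 + η ^ 2)) :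
    ENNReal.ofReal (1 - η) ≤ minimaxRisk p s γ ε := by
  set m := p / k with hm
  have hm0 : 0 < m := Nat.div_pos (by omega) hk
  have hmk : k * m ≤ p := Nat.mul_div_le p k
  have hk' : (0 : ℝ) < k := by exact_mod_cast hk
  have hm' : (0 : ℝ) < m := by exact_mod_cast hm0
  have hkp' : 2 * (k : ℝ) ≤ p := by exact_mod_cast hkp
  have hp' : (0 : ℝ) < p := by linarith
  have hpm : (p : ℝ) ≤ 2 * (m * k) := by
    have h2 : p < k * (m + 1) := Nat.lt_mul_div_succ p hk
    have h3 : k * (m + 1) ≤ 2 * (m * k) := by nlinarith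
    exact_mod_cast h2.le.trans h3
  let e : Fin k × Fin m ↪ Fin p :=
    finProdFinEquiv.toEmbedding.trans (Fin.castLEEmb hmk)
  have : Nonempty (Fin m) := ⟨⟨0, hm0⟩⟩
  refine le_minimaxRisk_of_secondMoment h0 h1 (fun f : Fin k → Fin m => blockSignal e a f) hη
    (sum_exp_blockSignal_le e hm0 (sq_nonneg η) (le_trans ?_ hchi)) fun f => ⟨?_, ?_⟩
  · have hexp : 0 ≤ Real.exp (a ^ 2) - 1 := by linarith [Real.one_le_exp (sq_nonneg a)]
    rw [div_le_div_iff₀ hm' hp']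
    calc k * (Real.exp (a ^ 2) - 1) * p ≤ k * (Real.exp (a ^ 2) - 1) * (2 * (m * k)) := by gcongr
      _ = _ := by ring
  · refine abs_le_of_sq_le_sq' ?_ (norm_nonneg _) |>.2
    refine hε.trans ?_
    have hcent : ∀ i, (WithLp.toLp 2 (fun i => √(1 - γ) * blockSignal e a f i) -
        avg (WithLp.toLp 2 (fun i => √(1 - γ) * blockSignal e a f i)) • ones p :
          EuclideanSpace ℝ (Fin p)) i ^ 2 =
        (1 - γ) * (blockSignal e a f i - (∑ j, blockSignal e a f j) / p) ^ 2 := by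
      intro i
      simp only [avg, ones, PiLp.sub_apply, PiLp.smul_apply, smul_eq_mul, mul_one,
        ← Finset.mul_sum]
      rw [mul_div_assoc, ← mul_sub, mul_pow, Real.sq_sqrt (by linarith)]
    rw [EuclideanSpace.real_norm_sq_eq, Finset.sum_congr rfl fun i _ => hcent i, ← Finset.mul_sum,
      sum_sub_avg_sq, sum_blockSignal]
    have hsq : ∑ i, blockSignal e a f i ^ 2 = k * a ^ 2 := by
      simp only [sq (blockSignal e a f _)]
      rw [sum_blockSignal_mul_blockSignal]
      simp
    rw [hsq]
    refine mul_le_mul_of_nonneg_left ?_ (by linarith)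
    have : (k * a) ^ 2 / p ≤ k * a ^ 2 / 2 := by
      rw [div_le_div_iff₀ hp' (by norm_num)]
      calc (k * a) ^ 2 * 2 = k * a ^ 2 * (2 * k) := by ring
        _ ≤ k * a ^ 2 * p := by gcongr
    linarith
  · refine le_trans ?_ ((card_support_blockSignal_le e a f).trans hks)
    have : √(1 - γ) ≠ 0 := (Real.sqrt_pos.2 (by linarith)).ne'
    simp [sparsity, this]

/-- Below a small multiple of `ψ₁` the block prior with `s` blocks in the sparse regime, and with
`⌊√p⌋` blocks in the dense regime, defeats every test. -/
theorem exists_lower_const {η : ℝ} (hη : 0 < η) : ∃ cη : ℝ, 0 < cη ∧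
    ∀ (p s : ℕ) (γ : ℝ), Config p s γ → ∀ c : ℝ, 0 < c → c < cη →
      ENNReal.ofReal (1 - η) ≤ minimaxRisk p s γ (c * √(psiSq p s γ)) := by
  set τ := Real.log (1 + η ^ 2) with hτ
  have hτ0 : 0 < τ := Real.log_pos (by have := sq_pos_of_pos hη; linarith)
  refine ⟨√(min (1 / 4) (τ / 16)), Real.sqrt_pos.2 (by positivity),
    fun p s γ hcfg c hc hcη => ?_⟩
  have hψ := psiSq_pos hcfg
  obtain ⟨hp, hs, hsp, h0, h1⟩ := hcfg
  have hc2 : c ^ 2 < min (1 / 4) (τ / 16) := (Real.lt_sqrt hc.le).1 hcη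
  have hc4 : c ^ 2 < 1 / 4 := hc2.trans_le (min_le_left _ _)
  have hcτ : c ^ 2 < τ / 16 := hc2.trans_le (min_le_right _ _)
  have hp2 : (2 : ℝ) ≤ p := by exact_mod_cast hp
  have hs1 : (1 : ℝ) ≤ s := by exact_mod_cast hs
  have hε2 : (c * √(psiSq p s γ)) ^ 2 = c ^ 2 * psiSq p s γ := by
    rw [mul_pow, Real.sq_sqrt hψ.le]
  rcases lt_or_ge (s : ℝ) √(p : ℝ) with hlt | hge
  · have hψe : psiSq p s γ = (1 - γ) * s * Real.log (1 + p / (s : ℝ) ^ 2) := if_pos hlt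
    have hs2 : s ^ 2 < p := by
      have : (s : ℝ) ^ 2 < p := (Real.lt_sqrt (by linarith)).1 hlt
      exact_mod_cast this
    set L := Real.log (1 + p / (s : ℝ) ^ 2) with hL
    have hq : 0 < (p : ℝ) / (s : ℝ) ^ 2 := by positivity
    have hL0 : 0 ≤ L := Real.log_nonneg (by linarith)
    refine le_minimaxRisk_of_block (k := s) (a := √(2 * c ^ 2 * L)) h0 h1 hη hs le_rfl ?_ ?_ ?_
    · rcases Nat.lt_or_ge s 2 with h | h
      · omega
      · nlinarith
    · rw [hε2, hψe, Real.sq_sqrt (by positivity)]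
      exact le_of_eq (by ring)
    · rw [Real.sq_sqrt (by positivity)]
      -- Bernoulli's inequality for the exponent `2 c ^ 2 ≤ 1`.
      have hbern : Real.exp (2 * c ^ 2 * L) ≤ 1 + 2 * c ^ 2 * (p / (s : ℝ) ^ 2) := by
        have h2 := rpow_one_add_le_one_add_mul_self (s := (p : ℝ) / (s : ℝ) ^ 2)
          (by linarith) (p := 2 * c ^ 2) (by positivity) (by linarith)
        rwa [Real.rpow_def_of_pos (by linarith), ← hL, mul_comm L] at h2
      calc 2 * (s : ℝ) ^ 2 * (Real.exp (2 * c ^ 2 * L) - 1) / p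
          ≤ 2 * (s : ℝ) ^ 2 * (2 * c ^ 2 * (p / (s : ℝ) ^ 2)) / p := by
            gcongr; linarith
        _ = 4 * c ^ 2 := by field_simp; ring
        _ ≤ τ := by linarith
  · have hψe : psiSq p s γ = (1 - γ) * √p := if_neg (not_lt.2 hge)
    -- Both `k ^ 2 ≤ p` and `√p ≤ 2 k`; for `p ≥ 2` moreover `2 k ≤ p`.
    set k := Nat.sqrt p with hk
    have hk1 : 1 ≤ k := Nat.sqrt_pos.2 (by omega)
    have hkk : k ^ 2 ≤ p := Nat.sqrt_le' p
    have hk1' : (1 : ℝ) ≤ k := by exact_mod_cast hk1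
    have hkk' : (k : ℝ) ^ 2 ≤ p := by exact_mod_cast hkk
    have hks : k ≤ s := by
      have : (k : ℝ) ≤ s := (Real.le_sqrt_of_sq_le hkk').trans hge
      exact_mod_cast this
    have hrk : √(p : ℝ) ≤ 2 * k := by
      rw [Real.sqrt_le_left (by positivity)]
      have h2 : p < (k + 1) ^ 2 := Nat.lt_succ_sqrt' p
      have h2' : (p : ℝ) < (k + 1) ^ 2 := by exact_mod_cast h2
      nlinarith
    refine le_minimaxRisk_of_block (k := k) (a := 2 * c) h0 h1 hη hk1 hks ?_ ?_ ?_
    · rcases Nat.lt_or_ge k 2 with h | h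
      · omega
      · nlinarith
    · rw [hε2, hψe]
      calc c ^ 2 * ((1 - γ) * √p) = (1 - γ) * (c ^ 2 * √p) := by ring
        _ ≤ (1 - γ) * (c ^ 2 * (2 * k)) := by
          have : 0 ≤ 1 - γ := by linarith
          gcongr
        _ = _ := by ring
    · have hx : |(2 * c) ^ 2| ≤ 1 := by
        rw [abs_of_nonneg (sq_nonneg _)]
        linarith
      have hexp : Real.exp ((2 * c) ^ 2) - 1 ≤ 8 * c ^ 2 := by
        have h2 := (le_abs_self _).trans (Real.abs_exp_sub_one_le hx)
        rw [abs_of_nonneg (sq_nonneg _)] at h2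
        linarith
      calc 2 * (k : ℝ) ^ 2 * (Real.exp ((2 * c) ^ 2) - 1) / p
          ≤ 2 * p * (8 * c ^ 2) / p := by
            have : 0 ≤ Real.exp ((2 * c) ^ 2) - 1 := by
              linarith [Real.one_le_exp (sq_nonneg (2 * c))]
            gcongr
        _ = 16 * c ^ 2 := by field_simp; ring
        _ ≤ τ := by linarith

/-! ### Uniqueness of the rate -/

lemma minimaxRisk_antitone (p s : ℕ) (γ : ℝ) : Antitone (minimaxRisk p s γ) := by
  intro ε ε' h
  refine iInf₂_mono fun φ _ => add_le_add le_rfl ?_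
  exact biSup_mono fun θ hθ => ⟨h.trans hθ.1, hθ.2⟩

/-- Two minimax separation rates are comparable: at error level `1 / 4` the small multiples of one
lie below the large multiples of the other. -/
lemma IsMinimaxSeparationRate.exists_mul_lt {ε δ : ℕ → ℕ → ℝ → ℝ}
    (hε : IsMinimaxSeparationRate ε) (hδ : IsMinimaxSeparationRate δ) :
    ∃ a : ℝ, 0 < a ∧ ∀ (p s : ℕ) (γ : ℝ), Config p s γ → a * δ p s γ < ε p s γ := by
  obtain ⟨C, hC, hup⟩ := hε.upper (1 / 4) (by norm_num) (by norm_num)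
  obtain ⟨c, hc, hlow⟩ := hδ.lower (1 / 4) (by norm_num) (by norm_num)
  refine ⟨c / 2 / (C + 1), by positivity, fun p s γ hcfg => ?_⟩
  by_contra! hle
  have h1 := hup p s γ hcfg (C + 1) (by linarith)
  have h2 := hlow p s γ hcfg (c / 2) (by positivity) (by linarith)
  have h3 : (C + 1) * ε p s γ ≤ c / 2 * δ p s γ := by
    calc (C + 1) * ε p s γ ≤ (C + 1) * (c / 2 / (C + 1) * δ p s γ) := by gcongr
      _ = _ := by field_simp
  have h4 := (h2.trans (minimaxRisk_antitone p s γ h3)).trans h1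
  rw [ENNReal.ofReal_le_ofReal_iff (by norm_num)] at h4
  norm_num at h4

theorem isMinimaxSeparationRate_sqrt_psiSq :
    IsMinimaxSeparationRate fun p s γ => √(psiSq p s γ) where
  upper _ hη _ := exists_upper_const hη
  lower _ hη _ := exists_lower_const hη

end EquicorrelatedTesting

theorem mainTheorem2 :
    EquicorrelatedTesting.IsMinimaxSeparationRate
        (fun p s γ => √(EquicorrelatedTesting.psiSq p s γ)) ∧
      ∀ ε : ℕ → ℕ → ℝ → ℝ, EquicorrelatedTesting.IsMinimaxSeparationRate ε →
        ∃ a b : ℝ, 0 < a ∧ 0 < b ∧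
          ∀ (p s : ℕ) (γ : ℝ), EquicorrelatedTesting.Config p s γ →
            a * EquicorrelatedTesting.psiSq p s γ ≤ ε p s γ ^ 2 ∧
              ε p s γ ^ 2 ≤ b * EquicorrelatedTesting.psiSq p s γ := by
  have hψ := EquicorrelatedTesting.isMinimaxSeparationRate_sqrt_psiSq
  refine ⟨hψ, fun ε hε => ?_⟩
  obtain ⟨a, ha, hlow⟩ := hε.exists_mul_lt hψ
  obtain ⟨b, hb, hup⟩ := hψ.exists_mul_lt hε
  refine ⟨a ^ 2, (b ^ 2)⁻¹, by positivity, by positivity, fun p s γ hcfg => ?_⟩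
  have hpos := EquicorrelatedTesting.psiSq_pos hcfg
  have h1 := hlow p s γ hcfg
  have h2 := hup p s γ hcfg
  have hsqrt : √(EquicorrelatedTesting.psiSq p s γ) ^ 2 = EquicorrelatedTesting.psiSq p s γ :=
    Real.sq_sqrt hpos.le
  have haψ : 0 ≤ a * √(EquicorrelatedTesting.psiSq p s γ) := by positivity
  have hε0 : 0 ≤ ε p s γ := haψ.trans h1.le
  constructor
  · have h3 := pow_le_pow_left₀ haψ h1.le 2
    rwa [mul_pow, hsqrt] at h3
  · have h3 := pow_le_pow_left₀ (by positivity) h2.le 2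
    rw [mul_pow, hsqrt] at h3
    rwa [le_inv_mul_iff₀ (by positivity)]
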